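/- Let $\theta\in\mathbb R$ and $\tau\in\mathbb C$ with $\Im\tau>0$. Let $A_\theta$ be the universal $C^*$-algebra generated by unitaries $U,V$ with $VU=e^{2\pi i\theta}UV$, with the action $\alpha_s(U^nV^m)=e^{i(s_1n+s_2m)}U^nV^m$ of $\mathbb R^2$, let $A_\theta^\infty$ be the $*$-algebra of those $a\in A_\theta$ for which $s\mapsto\alpha_s(a)$ is smooth, let $\delta_1,\delta_2$ be the derivations of $A_\theta^\infty$ with $\delta_1(U)=U,\ \delta_1(V)=0,\ \delta_2(U)=0,\ \delta_2(V)=V$ (that is, $\delta_j=-i\,\partial_{s_j}\alpha_s|_{s=0}$), and let $\varphi$ be the canonical trace, $\varphi(\sum a_{mn}U^mV^n)=a_{00}$. Put $g_\tau^{-1}=(g^{jk})=\begin{pmatrix}1&\Re\tau\\ \Re\tau&|\tau|^2\end{pmatrix}$. Let $\mathcal H^+=\mathcal H^{(0)}\oplus\mathcal H^{(2)}$ and $\mathcal H^-=\mathcal H^{(1)}$ be the completions of $A_\theta^\infty\oplus A_\theta^\infty$ for the inner products $$\langle (f,\omega),(f',\omega')\rangle=\tfrac1{\Im\tau}\varphi(f'^*f)+\Im(\tau)\,\varphi(\omega'^*\omega),\qquad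 \langle (a_1,a_2),(b_1,b_2)\rangle=\tfrac1{\Im\tau}\sum_{j,k}g^{jk}\varphi(b_k^*a_j),$$ and $\mathcal H=\mathcal H^+\oplus\mathcal H^-$. On smooth elements define $d:\mathcal H^+\to\mathcal H^-$ and $d^*:\mathcal H^-\to\mathcal H^+$ by $$d=\begin{pmatrix} i\delta_1 & i|\tau|^2\delta_2+i\Re(\tau)\delta_1\\ i\delta_2 & -i\Re(\tau)\delta_2-i\delta_1\end{pmatrix},\qquad d^*=\begin{pmatrix}-i\delta_1-i\Re(\tau)\delta_2 & -i\Re(\tau)\delta_1-i|\tau|^2\delta_2\\ -i\delta_2 & i\delta_1\end{pmatrix}.$$ A modular spectral triple $(\mathcal A,\mathcal K,D)$ with automorphism $\sigma$ consists of a unital involutive algebra $\mathcal A$ with a $*$-representation on a Hilbert space $\mathcal K$, an automorphism $\sigma$ of $\mathcal A$ with $\sigma(a^*)=\sigma^{-1}(a)^*$, and a self-adjoint operator $D$ on $\mathcal K$ with compact resolvent such that every $a\in\mathcal A$ preserves the domain of $D$ and $Da-\sigma(a)D$ is bounded. Its transpose is $(\mathcal A^{\rm op},\bar{\mathcal K},D^t)$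 on the dual Hilbert space $\bar{\mathcal K}$, with the transposed action and the automorphism $a^{\rm op}\mapsto(\sigma^{-1}(a))^{\rm op}$. Two triples over the same algebra are isomorphic if they have the same automorphism and a unitary of the Hilbert spaces intertwines the representations and the (unbounded) operators. Let $h=h^*\in A_\theta^\infty$ and $k=e^{h/2}$, and let $R_k$ denote right multiplication by $k$. Let $$\tilde D_h=\begin{pmatrix}0&R_k\circ d^*\\ d\circ R_k&0\end{pmatrix}\ \text{ with respect to } \mathcal H=\mathcal H^+\oplus\mathcal H^-,\qquad \bar D_h=\begin{pmatrix}0&kd\\ d^*k&0\end{pmatrix}\ \text{ with respect to } \mathcal H=\mathcal H^-\oplus\mathcal H^+,$$ where $k$ acts by left multiplication, and both operators are the closures of the operators so defined on smooth elements. Then: 1. $((A_\theta^\infty)^{\rm op},\mathcal H,\tilde D_h)$, with $(A_\theta^\infty)^{\rm op}$ acting by right multiplication, is a modular spectral triple for the automorphism $a^{\rm op}\mapsto(k^{-1}ak)^{\rm op}$. 2. $(A_\theta^\infty,\mathcal H,\bar D_h)$, with $A_\theta^\infty$ acting by left multiplication, is a modular spectral triple for the automorphism $a\mapsto kak^{-1}$,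 and, under the identification $((A_\theta^\infty)^{\rm op})^{\rm op}=A_\theta^\infty$, it is isomorphic to the transpose of the triple in 1. -/

import Mathlib

open scoped InnerProductSpace ContDiff

noncomputable section

namespace ModularTriple

section Dual

variable {H : Type*} [NormedAddCommGroup H] [InnerProductSpace ℂ H] [CompleteSpace H]

/-- The dual of a complex Hilbert space is a Hilbert space for the dual norm; its inner product is
the one that makes the conjugate-linear Riesz map `ξ ↦ ⟪ξ, ·⟫` anti-unitary. -/
instance dualInnerProductSpace : InnerProductSpace ℂ (StrongDual ℂ H) where
  inner ℓ m := ⟪(InnerProductSpace.toDual ℂ H).symm m, (InnerProductSpace.toDual ℂ H).symm ℓ⟫_ℂ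
  norm_sq_eq_re_inner ℓ := by
    rw [← (InnerProductSpace.toDual ℂ H).symm.norm_map ℓ]
    exact norm_sq_eq_re_inner _
  conj_inner_symm ℓ m := inner_conj_symm _ _
  add_left ℓ m n := by rw [map_add, inner_add_right]
  smul_left ℓ m r := by rw [map_smulₛₗ, inner_smul_right]

/-- The transpose `ℓ ↦ ℓ ∘ T` of a bounded operator. -/
def transposeCLM (T : H →L[ℂ] H) : StrongDual ℂ H →L[ℂ] StrongDual ℂ H :=
  ContinuousLinearMap.precomp ℂ T

set_option linter.unusedSectionVars false in
lemma transposeCLM_apply (T : H →L[ℂ] H) (ℓ : StrongDual ℂ H) (x : H) :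
    transposeCLM T ℓ x = ℓ (T x) := rfl

/-- The transpose of an unbounded operator `D`: its graph consists of all pairs `(ℓ, m)` of
functionals with `m x = ℓ (D x)` on the domain of `D`. -/
def transposePMap (D : H →ₗ.[ℂ] H) : StrongDual ℂ H →ₗ.[ℂ] StrongDual ℂ H :=
  Submodule.toLinearPMap
    { carrier := {p | ∀ x : D.domain, p.2 x = p.1 (D x)}
      add_mem' := fun hp hq x => by simp [hp x, hq x]
      zero_mem' := fun x => by simp
      smul_mem' := fun c p hp x => by simp [hp x] }

lemma toDual_symm_transpose (T : H →L[ℂ] H) (ℓ : StrongDual ℂ H) :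
    (InnerProductSpace.toDual ℂ H).symm (transposeCLM T ℓ) =
      ContinuousLinearMap.adjoint T ((InnerProductSpace.toDual ℂ H).symm ℓ) := by
  refine ext_inner_right ℂ fun x => ?_
  rw [InnerProductSpace.toDual_symm_apply, ContinuousLinearMap.adjoint_inner_left,
    InnerProductSpace.toDual_symm_apply, transposeCLM_apply]

lemma transposeCLM_star (T : H →L[ℂ] H) : transposeCLM (star T) = star (transposeCLM T) := by
  refine (ContinuousLinearMap.eq_adjoint_iff _ _).2 fun ℓ m => ?_
  change ⟪(InnerProductSpace.toDual ℂ H).symm m,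
    (InnerProductSpace.toDual ℂ H).symm (transposeCLM (star T) ℓ)⟫_ℂ =
    ⟪(InnerProductSpace.toDual ℂ H).symm (transposeCLM T m),
      (InnerProductSpace.toDual ℂ H).symm ℓ⟫_ℂ
  rw [toDual_symm_transpose, toDual_symm_transpose, ContinuousLinearMap.star_eq_adjoint,
    ContinuousLinearMap.adjoint_adjoint, ContinuousLinearMap.adjoint_inner_left]

end Dual

/-- `R` is the bounded (everywhere defined) two-sided inverse of `D - z`. -/
def IsResolventAt {H : Type*} [NormedAddCommGroup H] [InnerProductSpace ℂ H]
    (D : H →ₗ.[ℂ] H) (z : ℂ) (R : H →L[ℂ] H) : Prop :=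
  (∀ x : D.domain, R (D x - z • (x : H)) = x) ∧
    ∀ y : H, ∃ hy : R y ∈ D.domain, D ⟨R y, hy⟩ - z • R y = y

/-- The resolvent set of `D` is nonempty and all resolvents of `D` are compact. -/
def HasCompactResolvent {H : Type*} [NormedAddCommGroup H] [InnerProductSpace ℂ H]
    (D : H →ₗ.[ℂ] H) : Prop :=
  (∃ z R, IsResolventAt D z R) ∧ ∀ z R, IsResolventAt D z R → IsCompactOperator R

end ModularTriple

/-- The data `(A, H, D)` and `σ` of a twisted triple: an involutive algebra `A` represented on a
Hilbert space `H`, an unbounded operator `D` on `H` and an automorphism `σ` of `A`. -/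
structure TwistedTriple (A H : Type*) [Ring A] [StarRing A] [Algebra ℂ A]
    [NormedAddCommGroup H] [InnerProductSpace ℂ H] [CompleteSpace H] where
  rep : A →⋆ₐ[ℂ] (H →L[ℂ] H)
  dirac : H →ₗ.[ℂ] H
  twist : A ≃ₐ[ℂ] A

namespace TwistedTriple

open ModularTriple

variable {A H : Type*} [Ring A] [StarRing A] [Algebra ℂ A]
    [NormedAddCommGroup H] [InnerProductSpace ℂ H] [CompleteSpace H]

/-- The data form a modular (twisted) spectral triple: `σ (a*) = (σ⁻¹ a)*`, the operator `D` is
self-adjoint with compact resolvent, and for every `a` the twisted commutator `D a - σ(a) D` is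
defined on the domain of `D` and bounded. -/
structure IsModularSpectralTriple (T : TwistedTriple A H) : Prop where
  twist_star : ∀ a, T.twist (star a) = star (T.twist.symm a)
  isSelfAdjoint : IsSelfAdjoint T.dirac
  compactResolvent : HasCompactResolvent T.dirac
  rep_mem_domain : ∀ a, ∀ x ∈ T.dirac.domain, T.rep a x ∈ T.dirac.domain
  bounded_twistedCommutator : ∀ a, ∃ C : ℝ, ∀ (x : T.dirac.domain)
    (hx : T.rep a x ∈ T.dirac.domain),
    ‖T.dirac ⟨T.rep a x, hx⟩ - T.rep (T.twist a) (T.dirac x)‖ ≤ C * ‖(x : H)‖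

open MulOpposite in
/-- The transposed triple over the opposite algebra, on the dual Hilbert space, with the transposed
action, the transposed operator and the automorphism `a^op ↦ (σ⁻¹ a)^op`. -/
def transpose (T : TwistedTriple A H) : TwistedTriple Aᵐᵒᵖ (StrongDual ℂ H) where
  rep :=
    { toFun := fun a => transposeCLM (T.rep a.unop)
      map_one' := by ext; simp [transposeCLM_apply]
      map_mul' := fun a b => by ext; simp [transposeCLM_apply]
      map_zero' := by ext; simp [transposeCLM_apply]
      map_add' := fun a b => by ext; simp [transposeCLM_apply]
      commutes' := fun r => by ext; simp [transposeCLM_apply, Algebra.algebraMap_eq_smul_one]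
      map_star' := fun a => by rw [unop_star, map_star, transposeCLM_star] }
  dirac := transposePMap T.dirac
  twist := AlgEquiv.op T.twist.symm

/-- Two triples are isomorphic over an identification `ι` of their algebras: `ι` intertwines the
automorphisms, and a unitary of the Hilbert spaces intertwines the actions and carries the one
unbounded operator (with its domain) to the other. -/
def IsIsomorphic {A' H' : Type*} [Ring A'] [StarRing A'] [Algebra ℂ A']
    [NormedAddCommGroup H'] [InnerProductSpace ℂ H'] [CompleteSpace H']
    (T : TwistedTriple A H) (T' : TwistedTriple A' H') (ι : A ≃⋆ₐ[ℂ] A') : Prop :=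
  (∀ a, ι (T.twist a) = T'.twist (ι a)) ∧
  ∃ W : H ≃ₗᵢ[ℂ] H', (∀ a x, W (T.rep a x) = T'.rep (ι a) (W x)) ∧
    ∀ x y, (x, y) ∈ T.dirac.graph ↔ (W x, W y) ∈ T'.dirac.graph

end TwistedTriple

/-- The canonical identification of an involutive algebra with its double opposite. -/
def opOpStar (A : Type*) [Ring A] [StarRing A] [Algebra ℂ A] : A ≃⋆ₐ[ℂ] Aᵐᵒᵖᵐᵒᵖ where
  toRingEquiv := RingEquiv.opOp A
  map_star' _ := rfl
  map_smul' _ _ := rfl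


namespace NCTorus

/-- The separable infinite-dimensional Hilbert space `ℓ²(ℤ²)`. -/
abbrev L2 : Type := lp (fun _ : ℤ × ℤ => ℂ) 2

/-- The phase `e^{2πiθ}`. -/
def phase (θ : ℝ) : Circle := Circle.exp (2 * Real.pi * θ)

/-- All pairs `(u, v)` of unitaries on a separable infinite-dimensional Hilbert space with
`v u = e^{2πiθ} u v`. -/
structure Rep (θ : ℝ) : Type where
  u : L2 →L[ℂ] L2
  v : L2 →L[ℂ] L2
  hu : u ∈ unitary (L2 →L[ℂ] L2)
  hv : v ∈ unitary (L2 →L[ℂ] L2)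
  comm : v * u = (phase θ : ℂ) • (u * v)

/-- The set of pairs carries the discrete topology: every function on it is continuous. -/
instance (θ : ℝ) : TopologicalSpace (Rep θ) := ⊥

instance (θ : ℝ) : DiscreteTopology (Rep θ) := ⟨rfl⟩

instance : Nontrivial L2 := ⟨⟨lp.single 2 (0, 0) 1, 0, fun h => by
  have := congrArg (fun x : L2 => x (0, 0)) h
  simp at this⟩⟩

/-- The C*-algebra of all bounded families of operators indexed by the pairs in `Rep θ`. -/
def Ambient (θ : ℝ) : Type := BoundedContinuousFunction (Rep θ) (L2 →L[ℂ] L2)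

instance (θ : ℝ) : CStarAlgebra (Ambient θ) :=
  inferInstanceAs (CStarAlgebra (BoundedContinuousFunction (Rep θ) (L2 →L[ℂ] L2)))

instance (θ : ℝ) : FunLike (Ambient θ) (Rep θ) (L2 →L[ℂ] L2) :=
  inferInstanceAs (FunLike (BoundedContinuousFunction (Rep θ) (L2 →L[ℂ] L2)) _ _)

lemma norm_le_one_of_unitary {u : L2 →L[ℂ] L2} (hu : u ∈ unitary (L2 →L[ℂ] L2)) : ‖u‖ ≤ 1 :=
  CStarRing.norm_of_mem_unitary hu |>.le

/-- The universal unitary `U`: the family of all first components. -/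
def genU (θ : ℝ) : Ambient θ :=
  BoundedContinuousFunction.ofNormedAddCommGroupDiscrete (fun p : Rep θ => p.u) 1
    (fun p => norm_le_one_of_unitary p.hu)

/-- The universal unitary `V`: the family of all second components. -/
def genV (θ : ℝ) : Ambient θ :=
  BoundedContinuousFunction.ofNormedAddCommGroupDiscrete (fun p : Rep θ => p.v) 1
    (fun p => norm_le_one_of_unitary p.hv)

/-- The noncommutative two torus `A_θ`, the universal C*-algebra generated by two unitaries `U`, `V`
with `V U = e^{2πiθ} U V`: the norm of a `*`-polynomial in `U`, `V` is the supremum of the norms of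
its values at all pairs of such unitaries on a separable Hilbert space. -/
def A (θ : ℝ) : StarSubalgebra ℂ (Ambient θ) :=
  (StarAlgebra.adjoin ℂ {genU θ, genV θ}).topologicalClosure

lemma circle_smul_mem_unitary (c : Circle) {u : L2 →L[ℂ] L2}
    (hu : u ∈ unitary (L2 →L[ℂ] L2)) : (c : ℂ) • u ∈ unitary (L2 →L[ℂ] L2) := by
  have hc : (starRingEnd ℂ) (c : ℂ) * c = 1 := by
    rw [← Complex.normSq_eq_conj_mul_self]; simp
  have hc' : (c : ℂ) * (starRingEnd ℂ) (c : ℂ) = 1 := by rw [mul_comm, hc]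
  rw [Unitary.mem_iff] at hu ⊢
  constructor
  · rw [star_smul, smul_mul_smul_comm, hu.1]; simp [hc]
  · rw [star_smul, smul_mul_smul_comm, hu.2]; simp [hc']

/-- `(u, v) ↦ (e^{is₁} u, e^{is₂} v)`. -/
def Rep.rotate {θ : ℝ} (s : ℝ × ℝ) (p : Rep θ) : Rep θ where
  u := (Circle.exp s.1 : ℂ) • p.u
  v := (Circle.exp s.2 : ℂ) • p.v
  hu := circle_smul_mem_unitary _ p.hu
  hv := circle_smul_mem_unitary _ p.hv
  comm := by
    rw [smul_mul_smul_comm, smul_mul_smul_comm, p.comm, smul_comm (phase θ : ℂ),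
      mul_comm (Circle.exp s.1 : ℂ)]

/-- The action of `ℝ²` with `α_s(U) = e^{is₁} U`, `α_s(V) = e^{is₂} V`. -/
def α {θ : ℝ} (s : ℝ × ℝ) : Ambient θ →⋆ₐ[ℂ] Ambient θ where
  toFun a := BoundedContinuousFunction.compContinuous a
    ⟨Rep.rotate s, continuous_of_discreteTopology⟩
  map_one' := rfl
  map_mul' _ _ := rfl
  map_zero' := rfl
  map_add' _ _ := rfl
  commutes' _ := rfl
  map_star' _ := rfl

@[simp] lemma α_apply {θ : ℝ} (s : ℝ × ℝ) (a : Ambient θ) (p : Rep θ) :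
    α s a p = a (p.rotate s) := rfl

lemma Ambient.ext {θ : ℝ} {a b : Ambient θ} (h : ∀ p, a p = b p) : a = b := DFunLike.ext _ _ h

lemma norm_α_le {θ : ℝ} (s : ℝ × ℝ) (a : Ambient θ) : ‖α s a‖ ≤ ‖a‖ :=
  (BoundedContinuousFunction.norm_le (f := α s a) (norm_nonneg a)).2 fun p =>
    BoundedContinuousFunction.norm_coe_le_norm (f := a) (p.rotate s)

/-- `α_s` as a continuous linear map. -/
def αCLM (θ : ℝ) (s : ℝ × ℝ) : Ambient θ →L[ℂ] Ambient θ :=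
  LinearMap.mkContinuous (α (θ := θ) s).toAlgHom.toLinearMap 1
    (fun a => by rw [one_mul]; exact norm_α_le s a)

lemma α_add {θ : ℝ} (s t : ℝ × ℝ) (a : Ambient θ) : α s (α t a) = α (s + t) a := by
  refine Ambient.ext fun p => ?_
  simp only [α_apply]
  congr 1
  simp [Rep.rotate, smul_smul, Circle.exp_add, mul_comm]

lemma α_zero {θ : ℝ} (a : Ambient θ) : α 0 a = a := by
  refine Ambient.ext fun p => ?_
  simp only [α_apply]
  congr 1
  simp [Rep.rotate]

lemma α_genU {θ : ℝ} (s : ℝ × ℝ) : α s (genU θ) = (Circle.exp s.1 : ℂ) • genU θ := rfl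
lemma α_genV {θ : ℝ} (s : ℝ × ℝ) : α s (genV θ) = (Circle.exp s.2 : ℂ) • genV θ := rfl

lemma α_mem {θ : ℝ} (s : ℝ × ℝ) {a : Ambient θ} (ha : a ∈ A θ) : α s a ∈ A θ := by
  have h1 : A θ ≤ (A θ).comap (α (θ := θ) s) := by
    apply StarSubalgebra.topologicalClosure_minimal
    · rw [StarAlgebra.adjoin_le_iff]
      have hsub := StarSubalgebra.le_topologicalClosure (StarAlgebra.adjoin ℂ {genU θ, genV θ})
      have hU : genU θ ∈ A θ := hsub (StarAlgebra.subset_adjoin ℂ _ (by simp))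
      have hV : genV θ ∈ A θ := hsub (StarAlgebra.subset_adjoin ℂ _ (by simp))
      rintro x (rfl | rfl)
      · exact (A θ).smul_mem hU _
      · exact (A θ).smul_mem hV _
    · exact (StarSubalgebra.isClosed_topologicalClosure _).preimage (αCLM θ s).continuous
  exact h1 ha

/-- The smooth subalgebra `A_θ^∞`: all `a ∈ A_θ` for which `s ↦ α_s(a)` is smooth. -/
def Smooth (θ : ℝ) : StarSubalgebra ℂ (Ambient θ) where
  carrier := {a | a ∈ A θ ∧ ContDiff ℝ ∞ fun s : ℝ × ℝ => α s a}
  mul_mem' ha hb := ⟨mul_mem ha.1 hb.1, by simpa only [map_mul] using ha.2.mul hb.2⟩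
  one_mem' := ⟨one_mem _, by simpa only [map_one] using contDiff_const⟩
  add_mem' ha hb := ⟨add_mem ha.1 hb.1, by simpa only [map_add] using ha.2.add hb.2⟩
  zero_mem' := ⟨zero_mem _, by simpa only [map_zero] using contDiff_const⟩
  algebraMap_mem' r := ⟨algebraMap_mem _ r, by
    simpa only [AlgHomClass.commutes] using contDiff_const⟩
  star_mem' ha := ⟨star_mem ha.1, by
    simp only [map_star]
    exact (starL' ℝ (A := Ambient θ)).contDiff.comp ha.2⟩

lemma contDiff_α {θ : ℝ} (a : Smooth θ) : ContDiff ℝ ∞ fun s : ℝ × ℝ => α s (a : Ambient θ) := a.2.2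

/-- `-i` times the derivative of `s ↦ α_s(a)` at `0` in the direction `e`. -/
def genVal {θ : ℝ} (e : ℝ × ℝ) (a : Ambient θ) : Ambient θ :=
  -Complex.I • fderiv ℝ (fun s : ℝ × ℝ => α s a) 0 e

lemma genVal_mem {θ : ℝ} (e : ℝ × ℝ) (a : Smooth θ) : genVal e (a : Ambient θ) ∈ Smooth θ := by
  have hd : Differentiable ℝ fun s : ℝ × ℝ => α s (a : Ambient θ) :=
    (contDiff_α a).differentiable (by simp)
  constructor
  · refine (A θ).smul_mem ?_ _
    have h1 : HasDerivAt (fun t : ℝ => α (t • e) (a : Ambient θ))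
        (fderiv ℝ (fun s : ℝ × ℝ => α s (a : Ambient θ)) 0 e) 0 := by
      have h2 := (hd ((0 : ℝ) • e)).hasFDerivAt.comp_hasDerivAt (0 : ℝ)
        ((hasDerivAt_id (0 : ℝ)).smul_const e)
      simp only [zero_smul, one_smul] at h2
      exact h2
    have h3 := h1.tendsto_slope_zero
    have hcl : IsClosed (A θ : Set (Ambient θ)) := StarSubalgebra.isClosed_topologicalClosure _
    refine hcl.mem_of_tendsto h3 (Filter.Eventually.of_forall fun t => ?_)
    have : ∀ x ∈ A θ, (t⁻¹ : ℝ) • x ∈ A θ := fun x hx => by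
      rw [← Complex.coe_smul]; exact (A θ).smul_mem hx _
    exact this _ (sub_mem (α_mem _ a.2.1) (α_mem _ a.2.1))
  · have key : (fun t : ℝ × ℝ => α t (genVal e (a : Ambient θ))) = fun t =>
        -Complex.I • fderiv ℝ (fun s : ℝ × ℝ => α s (a : Ambient θ)) t e := by
      funext t
      have h1 : HasFDerivAt (fun s : ℝ × ℝ => α (t + s) (a : Ambient θ))
          (fderiv ℝ (fun s : ℝ × ℝ => α s (a : Ambient θ)) t) 0 := by
        have := (hd (t + 0)).hasFDerivAt.comp (0 : ℝ × ℝ) ((hasFDerivAt_id (0 : ℝ × ℝ)).const_add t)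
        simp only [add_zero, ContinuousLinearMap.comp_id] at this
        exact this
      have h2 : HasFDerivAt (fun s : ℝ × ℝ => α (t + s) (a : Ambient θ))
          (((αCLM θ t).restrictScalars ℝ).comp
            (fderiv ℝ (fun s : ℝ × ℝ => α s (a : Ambient θ)) 0)) 0 := by
        have := ((αCLM θ t).restrictScalars ℝ).hasFDerivAt.comp (0 : ℝ × ℝ) (hd 0).hasFDerivAt
        refine this.congr_of_eventuallyEq (Filter.Eventually.of_forall fun s => ?_)
        exact (α_add t s _).symm
      have h3 := congrArg (fun L => L e) (h1.unique h2)
      have h4 : α t (genVal e (a : Ambient θ)) = -Complex.I •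
          α t (fderiv ℝ (fun s : ℝ × ℝ => α s (a : Ambient θ)) 0 e) :=
        map_smul (αCLM θ t) _ _
      rw [h4]
      congr 1
      exact h3.symm
    rw [key]
    exact (((contDiff_α a).fderiv_right (m := ∞) (by simp)).clm_apply contDiff_const).const_smul _

/-- The infinitesimal generator of the action in the direction `e`, normalized so that
`δ (1, 0) U = U` and `δ (0, 1) V = V`. -/
def δ {θ : ℝ} (e : ℝ × ℝ) : Smooth θ →ₗ[ℂ] Smooth θ where
  toFun a := ⟨genVal e (a : Ambient θ), genVal_mem e a⟩
  map_add' a b := by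
    apply Subtype.ext
    have ha := ((contDiff_α a).differentiable (by simp)) 0
    have hb := ((contDiff_α b).differentiable (by simp)) 0
    simp only [genVal, AddMemClass.coe_add, map_add]
    rw [fderiv_fun_add ha hb]
    exact smul_add _ _ _
  map_smul' c a := by
    apply Subtype.ext
    have ha := ((contDiff_α a).differentiable (by simp)) 0
    have h1 : (fun s : ℝ × ℝ => α s ((c • a : Smooth θ) : Ambient θ)) =
        fun s => c • α s (a : Ambient θ) := funext fun s => map_smul (α s) c (a : Ambient θ)
    change -Complex.I • fderiv ℝ (fun s : ℝ × ℝ => α s ((c • a : Smooth θ) : Ambient θ)) 0 e =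
      c • (-Complex.I • fderiv ℝ (fun s : ℝ × ℝ => α s (a : Ambient θ)) 0 e)
    rw [h1, fderiv_fun_const_smul ha c, smul_comm]
    rfl

/-- The derivation `δ₁`. -/
abbrev δ₁ {θ : ℝ} : Smooth θ →ₗ[ℂ] Smooth θ := δ (1, 0)

/-- The derivation `δ₂`. -/
abbrev δ₂ {θ : ℝ} : Smooth θ →ₗ[ℂ] Smooth θ := δ (0, 1)

lemma exp_mem_smooth {θ : ℝ} (a : Smooth θ) :
    NormedSpace.exp (a : Ambient θ) ∈ Smooth θ := by
  let _ : NormedAlgebra ℚ (Ambient θ) := NormedAlgebra.restrictScalars ℚ ℂ _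
  constructor
  · exact NormedSpace.exp_mem (R := ℂ) (StarSubalgebra.isClosed_topologicalClosure _) a.2.1
  · have : (fun s : ℝ × ℝ => α s (NormedSpace.exp (a : Ambient θ))) =
        fun s => NormedSpace.exp (α s (a : Ambient θ)) := by
      funext s
      exact NormedSpace.map_exp (α (θ := θ) s) (αCLM θ s).continuous _
    rw [this]
    have h : ContDiff ℝ ∞ (NormedSpace.exp : Ambient θ → Ambient θ) :=
      contDiff_iff_contDiffAt.2 fun x => (NormedSpace.exp_analytic (𝕂 := ℝ) x).contDiffAt
    exact h.comp (contDiff_α a)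


/-- `(c i * x (e i))_i`. -/
def shiftFun (c : ℤ × ℤ → Circle) (e : Equiv.Perm (ℤ × ℤ)) (x : L2) : L2 :=
  ⟨fun i => (c i : ℂ) * x (e i), by
    have h := (lp.memℓp x).summable (by norm_num)
    refine memℓp_gen ?_
    refine ((e.summable_iff (f := fun i => ‖x i‖ ^ (2 : ENNReal).toReal)).2 h).congr fun i => ?_
    rw [norm_mul, Circle.norm_coe, one_mul]
    rfl⟩

@[simp] lemma shiftFun_apply (c : ℤ × ℤ → Circle) (e : Equiv.Perm (ℤ × ℤ)) (x : L2) (i : ℤ × ℤ) :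
    shiftFun c e x i = (c i : ℂ) * x (e i) := rfl

/-- The weighted shift `x ↦ (c i * x (e i))_i` as a unitary of `ℓ²(ℤ²)`. -/
def wshift (c : ℤ × ℤ → Circle) (e : Equiv.Perm (ℤ × ℤ)) : L2 ≃ₗᵢ[ℂ] L2 where
  toFun := shiftFun c e
  invFun := shiftFun (fun i => (c (e.symm i))⁻¹) e.symm
  map_add' x y := by
    refine lp.ext (funext fun i => ?_)
    simp [mul_add]
  map_smul' r x := by
    refine lp.ext (funext fun i => ?_)
    simp [mul_left_comm]
  left_inv x := by
    refine lp.ext (funext fun i => ?_)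
    simp
  right_inv x := by
    refine lp.ext (funext fun i => ?_)
    simp
  norm_map' x := by
    have h2 : (0 : ℝ) < (2 : ENNReal).toReal := by norm_num
    rw [lp.norm_eq_tsum_rpow h2, lp.norm_eq_tsum_rpow h2]
    congr 1
    refine Eq.trans ?_ (e.tsum_eq (fun i => ‖x i‖ ^ (2 : ENNReal).toReal))
    refine tsum_congr fun i => ?_
    change ‖(c i : ℂ) * x (e i)‖ ^ _ = _
    rw [norm_mul, Circle.norm_coe, one_mul]

lemma wshift_apply (c : ℤ × ℤ → Circle) (e : Equiv.Perm (ℤ × ℤ)) (x : L2) (i : ℤ × ℤ) :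
    wshift c e x i = (c i : ℂ) * x (e i) := rfl

lemma wshift_symm_apply (c : ℤ × ℤ → Circle) (e : Equiv.Perm (ℤ × ℤ)) (x : L2) (i : ℤ × ℤ) :
    (wshift c e).symm x i = (((c (e.symm i))⁻¹ : Circle) : ℂ) * x (e.symm i) := rfl

/-- `(m, n) ↦ (m - 1, n)`. -/
def left : Equiv.Perm (ℤ × ℤ) := Equiv.prodCongr (Equiv.subRight 1) (Equiv.refl ℤ)

/-- `(m, n) ↦ (m, n - 1)`. -/
def down : Equiv.Perm (ℤ × ℤ) := Equiv.prodCongr (Equiv.refl ℤ) (Equiv.subRight 1)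

/-- Left multiplication by `U` on `ℓ²(ℤ²)`, where `e_{m,n}` stands for `U^m V^n`. -/
def regU : L2 ≃ₗᵢ[ℂ] L2 := wshift (fun _ => 1) left

/-- Left multiplication by `V` on `ℓ²(ℤ²)`: `V U^m V^n = e^{2πiθm} U^m V^{n+1}`. -/
def regV (θ : ℝ) : L2 ≃ₗᵢ[ℂ] L2 := wshift (fun i => phase θ ^ i.1) down

lemma mem_unitary_of_isometryEquiv (T : L2 ≃ₗᵢ[ℂ] L2) :
    (T : L2 →L[ℂ] L2) ∈ unitary (L2 →L[ℂ] L2) :=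
  (Unitary.linearIsometryEquiv.symm T).2

/-- The regular pair. -/
def reg (θ : ℝ) : Rep θ where
  u := regU
  v := regV θ
  hu := mem_unitary_of_isometryEquiv _
  hv := mem_unitary_of_isometryEquiv _
  comm := by
    refine ContinuousLinearMap.ext fun x => lp.ext (funext fun i => ?_)
    change wshift _ _ (wshift _ _ x) i = (phase θ : ℂ) * wshift _ _ (wshift _ _ x) i
    simp only [wshift_apply, left, down]
    obtain ⟨m, n⟩ := i
    simp only [Circle.coe_zpow, Circle.coe_one, one_mul, Equiv.prodCongr_apply, Prod.map,
      Equiv.subRight_apply, Equiv.refl_apply]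
    rw [← mul_assoc, ← zpow_one_add₀ (Circle.coe_ne_zero _), add_sub_cancel]

/-- The vector `e_{0,0}`. -/
def vacuum : L2 := lp.single 2 (0, 0) 1

/-- Evaluation at the regular pair. -/
def evalReg (θ : ℝ) : Ambient θ →⋆ₐ[ℂ] (L2 →L[ℂ] L2) where
  toFun a := a (reg θ)
  map_one' := rfl
  map_mul' _ _ := rfl
  map_zero' := rfl
  map_add' _ _ := rfl
  commutes' _ := rfl
  map_star' _ := rfl

lemma norm_evalReg_le {θ : ℝ} (a : Ambient θ) : ‖evalReg θ a‖ ≤ ‖a‖ :=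
  BoundedContinuousFunction.norm_coe_le_norm (f := a) (reg θ)

lemma continuous_evalReg (θ : ℝ) : Continuous (evalReg θ) :=
  continuous_eval_const (F := BoundedContinuousFunction (Rep θ) (L2 →L[ℂ] L2)) (reg θ)

/-- The canonical trace of `A_θ`, with `φ(∑ a_{mn} U^m V^n) = a_{00}`: the vector state of `e_{0,0}`
in the regular representation. -/
def φ {θ : ℝ} : Ambient θ →ₗ[ℂ] ℂ where
  toFun a := ⟪vacuum, evalReg θ a vacuum⟫_ℂ
  map_add' a b := by simp
  map_smul' c a := by simp

lemma φ_apply {θ : ℝ} (a : Ambient θ) : φ a = ⟪vacuum, evalReg θ a vacuum⟫_ℂ := rfl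

lemma φ_star_mul {θ : ℝ} (a b : Ambient θ) :
    φ (star a * b) = ⟪evalReg θ a vacuum, evalReg θ b vacuum⟫_ℂ := by
  have h : evalReg θ (star a * b) = star (evalReg θ a) * evalReg θ b := by
    rw [map_mul, map_star]
  rw [φ_apply, h]
  exact ContinuousLinearMap.adjoint_inner_right (evalReg θ a) _ _

lemma φ_star {θ : ℝ} (a : Ambient θ) : φ (star a) = (starRingEnd ℂ) (φ a) := by
  have h := φ_star_mul a 1
  rw [mul_one] at h
  rw [h, φ_apply, inner_conj_symm]
  simp

lemma continuous_φ {θ : ℝ} : Continuous (φ (θ := θ)) := by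
  have : Continuous fun a : Ambient θ => evalReg θ a vacuum :=
    (continuous_evalReg θ).clm_apply continuous_const
  exact continuous_const.inner this

lemma commute_of_mem {θ : ℝ} (T : L2 ≃ₗᵢ[ℂ] L2)
    (hU : (T : L2 →L[ℂ] L2) * (reg θ).u = (reg θ).u * T)
    (hV : (T : L2 →L[ℂ] L2) * (reg θ).v = (reg θ).v * T) {b : Ambient θ} (hb : b ∈ A θ) :
    (T : L2 →L[ℂ] L2) * evalReg θ b = evalReg θ b * T := by
  have hT := Unitary.mem_iff.1 (mem_unitary_of_isometryEquiv T)
  have hstar : ∀ S : L2 →L[ℂ] L2, (T : L2 →L[ℂ] L2) * S = S * T →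
      star (T : L2 →L[ℂ] L2) * S = S * star (T : L2 →L[ℂ] L2) := fun S h => by
    calc star (T : L2 →L[ℂ] L2) * S
        = star (T : L2 →L[ℂ] L2) * (S * T) * star (T : L2 →L[ℂ] L2) := by
          rw [mul_assoc, mul_assoc, hT.2, mul_one]
      _ = S * star (T : L2 →L[ℂ] L2) := by
          rw [← h, ← mul_assoc, hT.1, one_mul]
  have h1 : A θ ≤ (StarSubalgebra.centralizer ℂ {(T : L2 →L[ℂ] L2)}).comap (evalReg θ) := by
    apply StarSubalgebra.topologicalClosure_minimal
    · rw [StarAlgebra.adjoin_le_iff]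
      rintro x (rfl | rfl)
      · refine StarSubalgebra.mem_centralizer_iff ℂ |>.2 fun g hg => ?_
        rw [Set.mem_singleton_iff.1 hg]
        exact ⟨hU, hstar _ hU⟩
      · refine StarSubalgebra.mem_centralizer_iff ℂ |>.2 fun g hg => ?_
        rw [Set.mem_singleton_iff.1 hg]
        exact ⟨hV, hstar _ hV⟩
    · exact (Set.isClosed_centralizer _).preimage (continuous_evalReg θ)
  exact (StarSubalgebra.mem_centralizer_iff ℂ |>.1 (h1 hb) _ rfl).1

lemma φ_gen_comm {θ : ℝ} (S T : L2 ≃ₗᵢ[ℂ] L2) (g : Ambient θ) (hg : evalReg θ g = S)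
    (hU : (T : L2 →L[ℂ] L2) * (reg θ).u = (reg θ).u * T)
    (hV : (T : L2 →L[ℂ] L2) * (reg θ).v = (reg θ).v * T)
    (h1 : S vacuum = T vacuum) (h2 : S.symm vacuum = T.symm vacuum)
    {b : Ambient θ} (hb : b ∈ A θ) : φ (g * b) = φ (b * g) := by
  have hc := commute_of_mem T hU hV hb
  rw [φ_apply, φ_apply, map_mul, map_mul, hg]
  change ⟪vacuum, S (evalReg θ b vacuum)⟫_ℂ = ⟪vacuum, evalReg θ b (S vacuum)⟫_ℂ
  have hc' : T (evalReg θ b vacuum) = evalReg θ b (T vacuum) :=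
    congrArg (fun L : L2 →L[ℂ] L2 => L vacuum) hc
  rw [h1, ← hc', ← S.symm.inner_map_map, ← T.symm.inner_map_map vacuum (T _), h2]
  simp

lemma φ_genU_comm {θ : ℝ} {b : Ambient θ} (hb : b ∈ A θ) :
    φ (genU θ * b) = φ (b * genU θ) := by
  refine φ_gen_comm regU (wshift (fun i => phase θ ^ i.2) left) _ rfl ?_ ?_ ?_ ?_ hb
  · refine ContinuousLinearMap.ext fun x => lp.ext (funext fun i => ?_)
    change wshift _ _ (wshift _ _ x) i = wshift _ _ (wshift _ _ x) i
    simp [wshift_apply, left]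
  · refine ContinuousLinearMap.ext fun x => lp.ext (funext fun i => ?_)
    change wshift _ _ (wshift _ _ x) i = wshift _ _ (wshift _ _ x) i
    obtain ⟨m, n⟩ := i
    simp [wshift_apply, left, down, zpow_sub_one₀]
    ring
  · refine lp.ext (funext fun i => ?_)
    obtain ⟨m, n⟩ := i
    by_cases hn : n = 0
    · simp [regU, wshift_apply, left, vacuum, hn]
    · simp [regU, wshift_apply, left, vacuum, hn]
  · refine lp.ext (funext fun i => ?_)
    obtain ⟨m, n⟩ := i
    by_cases hn : n = 0
    · simp [regU, wshift_symm_apply, left, vacuum, hn]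
    · simp [regU, wshift_symm_apply, left, vacuum, hn]

lemma φ_genV_comm {θ : ℝ} {b : Ambient θ} (hb : b ∈ A θ) :
    φ (genV θ * b) = φ (b * genV θ) := by
  refine φ_gen_comm (regV θ) (wshift (fun _ => 1) down) _ rfl ?_ ?_ ?_ ?_ hb
  · refine ContinuousLinearMap.ext fun x => lp.ext (funext fun i => ?_)
    change wshift _ _ (wshift _ _ x) i = wshift _ _ (wshift _ _ x) i
    obtain ⟨m, n⟩ := i
    simp [wshift_apply, left, down]
  · refine ContinuousLinearMap.ext fun x => lp.ext (funext fun i => ?_)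
    change wshift _ _ (wshift _ _ x) i = wshift _ _ (wshift _ _ x) i
    simp [wshift_apply, down]
  · refine lp.ext (funext fun i => ?_)
    obtain ⟨m, n⟩ := i
    by_cases hn : m = 0
    · simp [regV, wshift_apply, down, vacuum, hn]
    · simp [regV, wshift_apply, down, vacuum, hn]
  · refine lp.ext (funext fun i => ?_)
    obtain ⟨m, n⟩ := i
    by_cases hn : m = 0
    · simp [regV, wshift_symm_apply, down, vacuum, hn]
    · simp [regV, wshift_symm_apply, down, vacuum, hn]

/-- `φ` is a trace on `A_θ`. -/
theorem φ_mul_comm {θ : ℝ} {a b : Ambient θ} (ha : a ∈ A θ) (hb : b ∈ A θ) :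
    φ (a * b) = φ (b * a) := by
  have hsub : StarAlgebra.adjoin ℂ {genU θ, genV θ} ≤ A θ :=
    StarSubalgebra.le_topologicalClosure _
  have h1 : ∀ x ∈ StarAlgebra.adjoin ℂ {genU θ, genV θ}, ∀ y ∈ A θ, φ (x * y) = φ (y * x) := by
    intro x hx
    induction hx using StarAlgebra.adjoin_induction with
    | mem x hx =>
      rcases hx with rfl | rfl
      · exact fun y hy => φ_genU_comm hy
      · exact fun y hy => φ_genV_comm hy
    | algebraMap r => exact fun y _ => by rw [Algebra.commutes]
    | add x y _ _ h1 h2 => exact fun z hz => by rw [add_mul, mul_add, map_add, map_add, h1 z hz, h2 z hz]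
    | mul x y hx hy h1 h2 =>
      exact fun z hz => by
        rw [mul_assoc, h1 _ (mul_mem (hsub hy) hz), mul_assoc, h2 _ (mul_mem hz (hsub hx)), mul_assoc]
    | star x _ h1 =>
      intro z hz
      have h2 := congrArg (starRingEnd ℂ) (h1 _ (star_mem hz))
      rw [← φ_star, ← φ_star, star_mul, star_mul, star_star] at h2
      exact h2.symm
  have hcl : IsClosed {x : Ambient θ | φ (x * b) = φ (b * x)} :=
    isClosed_eq (continuous_φ.comp (continuous_id.mul continuous_const))
      (continuous_φ.comp (continuous_const.mul continuous_id))
  exact closure_minimal (fun x hx => h1 x hx b hb) hcl ha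

/-- The trace on `A_θ^∞`. -/
def tr {θ : ℝ} : Smooth θ →ₗ[ℂ] ℂ := φ ∘ₗ (Smooth θ).subtype.toAlgHom.toLinearMap

/-- The vector of `ℓ²(ℤ²)` of Fourier coefficients of a smooth element. -/
def vec {θ : ℝ} : Smooth θ →ₗ[ℂ] L2 where
  toFun a := evalReg θ a vacuum
  map_add' a b := by simp
  map_smul' c a := by
    have : evalReg θ ((c • a : Smooth θ) : Ambient θ) = c • evalReg θ (a : Ambient θ) :=
      map_smul (evalReg θ) c (a : Ambient θ)
    rw [this]; rfl

lemma tr_star_mul {θ : ℝ} (a b : Smooth θ) : tr (star a * b) = ⟪vec a, vec b⟫_ℂ :=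
  φ_star_mul (a : Ambient θ) b

lemma tr_mul_comm {θ : ℝ} (a b : Smooth θ) : tr (a * b) = tr (b * a) := φ_mul_comm a.2.1 b.2.1

lemma norm_vec_mul_le {θ : ℝ} (a b : Smooth θ) : ‖vec (a * b)‖ ≤ ‖(a : Ambient θ)‖ * ‖vec b‖ := by
  have h : vec (a * b) = evalReg θ a (vec b) := by
    change evalReg θ ((a : Ambient θ) * b) vacuum = _
    rw [map_mul]; rfl
  rw [h]
  exact ((evalReg θ a).le_opNorm _).trans
    (mul_le_mul_of_nonneg_right (norm_evalReg_le _) (norm_nonneg _))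

lemma norm_vec_star {θ : ℝ} (a : Smooth θ) : ‖vec (star a)‖ = ‖vec a‖ := by
  have h : ⟪vec (star a), vec (star a)⟫_ℂ = ⟪vec a, vec a⟫_ℂ := by
    rw [← tr_star_mul, ← tr_star_mul, star_star, tr_mul_comm]
  rw [inner_self_eq_norm_sq_to_K, inner_self_eq_norm_sq_to_K] at h
  have h' : ‖vec (star a)‖ ^ 2 = ‖vec a‖ ^ 2 := by exact_mod_cast h
  exact (sq_eq_sq₀ (norm_nonneg _) (norm_nonneg _)).1 h'

lemma norm_vec_mul_le' {θ : ℝ} (a b : Smooth θ) : ‖vec (b * a)‖ ≤ ‖(a : Ambient θ)‖ * ‖vec b‖ := by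
  rw [← norm_vec_star, star_mul, ← norm_vec_star b]
  refine (norm_vec_mul_le _ _).trans_eq ?_
  congr 1
  exact norm_star (a : Ambient θ)

/-- The metric `g_τ⁻¹` on the dual of `ℝ²`. -/
def gInv (τ : UpperHalfPlane) : Matrix (Fin 2) (Fin 2) ℝ :=
  !![1, τ.re; τ.re, Complex.normSq τ]

set_option linter.unusedVariables false in
/-- Smooth forms, written as `((f, ω), (a₁, a₂))` with a function `f`, a two form `ω` and a one form
`(a₁, a₂)`, that is, as pairs of an even and an odd form. -/
def PreForms (θ : ℝ) (τ : UpperHalfPlane) : Type := (Fin 2 → Smooth θ) × (Fin 2 → Smooth θ)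

section Forms

variable {θ : ℝ} {τ : UpperHalfPlane}

instance : AddCommGroup (PreForms θ τ) :=
  inferInstanceAs (AddCommGroup ((Fin 2 → Smooth θ) × (Fin 2 → Smooth θ)))

instance : Module ℂ (PreForms θ τ) :=
  inferInstanceAs (Module ℂ ((Fin 2 → Smooth θ) × (Fin 2 → Smooth θ)))

/-- The inner product on forms, linear in the second argument:
`(1/Im τ) φ(f* f') + (Im τ) φ(ω* ω') + (1/Im τ) ∑ g^{jk} φ(a_k* a'_j)`. -/
def preInner (x y : PreForms θ τ) : ℂ :=
  (1 / τ.im : ℝ) * tr (star (x.1 0) * y.1 0) + (τ.im : ℝ) * tr (star (x.1 1) * y.1 1) +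
    (1 / τ.im : ℝ) * ∑ j, ∑ k, (gInv τ j k : ℂ) * tr (star (x.2 k) * y.2 j)

lemma preInner_self (x : PreForms θ τ) :
    preInner x x = ((1 / τ.im * ‖vec (x.1 0)‖ ^ 2 + τ.im * ‖vec (x.1 1)‖ ^ 2 +
      1 / τ.im * (‖vec (x.2 0 + (τ.re : ℂ) • x.2 1)‖ ^ 2 + τ.im ^ 2 * ‖vec (x.2 1)‖ ^ 2) : ℝ) : ℂ) := by
  simp only [preInner, tr_star_mul, gInv, Fin.sum_univ_two, Matrix.of_apply, Matrix.cons_val',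
    Matrix.cons_val_zero, Matrix.cons_val_one, Matrix.cons_val_fin_one]
  have h : ((‖vec (x.2 0 + (τ.re : ℂ) • x.2 1)‖ ^ 2 : ℝ) : ℂ) =
      ⟪vec (x.2 0), vec (x.2 0)⟫_ℂ + τ.re * ⟪vec (x.2 0), vec (x.2 1)⟫_ℂ +
      τ.re * ⟪vec (x.2 1), vec (x.2 0)⟫_ℂ + τ.re ^ 2 * ⟪vec (x.2 1), vec (x.2 1)⟫_ℂ := by
    have := inner_self_eq_norm_sq_to_K (𝕜 := ℂ) (vec (x.2 0 + (τ.re : ℂ) • x.2 1))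
    push_cast
    refine this.symm.trans ?_
    rw [map_add, map_smul]
    simp only [inner_add_left, inner_add_right, inner_smul_left, inner_smul_right,
      Complex.conj_ofReal]
    ring
  have hs : ∀ a : Smooth θ, ((‖vec a‖ : ℝ) : ℂ) ^ 2 = ⟪vec a, vec a⟫_ℂ := fun a =>
    (inner_self_eq_norm_sq_to_K (𝕜 := ℂ) (vec a)).symm
  have hn : Complex.normSq τ = τ.re ^ 2 + τ.im ^ 2 := by
    rw [Complex.normSq_apply]; simp [sq]
  rw [hn]
  push_cast at h ⊢
  rw [h, hs, hs, hs]
  ring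

/-- `preInner` is a positive semidefinite Hermitian form. -/
abbrev preCore (θ : ℝ) (τ : UpperHalfPlane) : PreInnerProductSpace.Core ℂ (PreForms θ τ) where
  inner := preInner
  conj_inner_symm x y := by
    simp only [preInner, tr_star_mul, map_add, map_mul, Complex.conj_ofReal, inner_conj_symm,
      map_sum]
    congr 2
    rw [Finset.sum_comm]
    refine Finset.sum_congr rfl fun j _ => Finset.sum_congr rfl fun k _ => ?_
    congr 2
    fin_cases j <;> fin_cases k <;> rfl
  re_inner_nonneg x := by
    rw [preInner_self, RCLike.re_eq_complex_re, Complex.ofReal_re]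
    have := τ.im_pos
    positivity
  add_left x y z := by
    have h1 : ∀ i, (x + y).1 i = x.1 i + y.1 i := fun _ => rfl
    have h2 : ∀ i, (x + y).2 i = x.2 i + y.2 i := fun _ => rfl
    simp only [preInner, h1, h2, star_add, add_mul, map_add, mul_add, Finset.sum_add_distrib]
    ring
  smul_left x y r := by
    have h1 : ∀ i, (r • x).1 i = r • x.1 i := fun _ => rfl
    have h2 : ∀ i, (r • x).2 i = r • x.2 i := fun _ => rfl
    simp only [preInner, h1, h2, tr_star_mul, map_smul, inner_smul_left, mul_add, Finset.mul_sum,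
      mul_left_comm]

instance : SeminormedAddCommGroup (PreForms θ τ) :=
  InnerProductSpace.Core.toSeminormedAddCommGroup (c := preCore θ τ)

instance : InnerProductSpace ℂ (PreForms θ τ) := InnerProductSpace.ofCore (preCore θ τ)

lemma inner_def (x y : PreForms θ τ) : ⟪x, y⟫_ℂ = preInner x y := rfl

/-- The Hilbert space `H = H^+ ⊕ H^-`, with `H^+ = H^(0) ⊕ H^(2)` (functions and two forms) and
`H^- = H^(1)` (one forms): the completion of the smooth forms. -/
abbrev Forms (θ : ℝ) (τ : UpperHalfPlane) : Type := UniformSpace.Completion (PreForms θ τ)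

lemma norm_sq_def (x : PreForms θ τ) :
    ‖x‖ ^ 2 = 1 / τ.im * ‖vec (x.1 0)‖ ^ 2 + τ.im * ‖vec (x.1 1)‖ ^ 2 +
      1 / τ.im * (‖vec (x.2 0 + (τ.re : ℂ) • x.2 1)‖ ^ 2 + τ.im ^ 2 * ‖vec (x.2 1)‖ ^ 2) := by
  have h := inner_self_eq_norm_sq_to_K (𝕜 := ℂ) x
  rw [inner_def, preInner_self] at h
  exact (Complex.ofReal_injective (h.trans (Complex.ofReal_pow _ 2).symm)).symm

/-- `T` applied to each of two entries. -/
def entrywise (T : Smooth θ →ₗ[ℂ] Smooth θ) : (Fin 2 → Smooth θ) →ₗ[ℂ] (Fin 2 → Smooth θ) :=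
  LinearMap.pi fun i => T ∘ₗ LinearMap.proj i

/-- A bounded operator on functions, applied to all four components of a form. -/
def boundedMap (T : Smooth θ →ₗ[ℂ] Smooth θ) (C : ℝ) (hC : 0 ≤ C)
    (hT : ∀ a, ‖vec (T a)‖ ≤ C * ‖vec a‖) : PreForms θ τ →L[ℂ] PreForms θ τ :=
  LinearMap.mkContinuous
    (LinearMap.prodMap (entrywise T) (entrywise T) : PreForms θ τ →ₗ[ℂ] PreForms θ τ) C
    (fun x => by
      have := τ.im_pos
      rw [← sq_le_sq₀ (norm_nonneg _) (by positivity), mul_pow, norm_sq_def, norm_sq_def]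
      have hT' : ∀ a, ‖vec (T a)‖ ^ 2 ≤ C ^ 2 * ‖vec a‖ ^ 2 := fun a => by
        rw [← mul_pow]; exact pow_le_pow_left₀ (norm_nonneg _) (hT a) 2
      change 1 / τ.im * ‖vec (T (x.1 0))‖ ^ 2 + τ.im * ‖vec (T (x.1 1))‖ ^ 2 +
        1 / τ.im * (‖vec (T (x.2 0) + (τ.re : ℂ) • T (x.2 1))‖ ^ 2 +
          τ.im ^ 2 * ‖vec (T (x.2 1))‖ ^ 2) ≤ _
      rw [← map_smul T, ← map_add T]
      calc _ ≤ 1 / τ.im * (C ^ 2 * ‖vec (x.1 0)‖ ^ 2) + τ.im * (C ^ 2 * ‖vec (x.1 1)‖ ^ 2) +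
            1 / τ.im * (C ^ 2 * ‖vec (x.2 0 + (τ.re : ℂ) • x.2 1)‖ ^ 2 +
              τ.im ^ 2 * (C ^ 2 * ‖vec (x.2 1)‖ ^ 2)) := by
            gcongr <;> exact hT' _
        _ = _ := by ring)

/-- Left multiplication by `a` on each component. -/
def leftMul (a : Smooth θ) : PreForms θ τ →L[ℂ] PreForms θ τ :=
  boundedMap (LinearMap.mulLeft ℂ a) ‖(a : Ambient θ)‖ (norm_nonneg _) (norm_vec_mul_le a)

/-- Right multiplication by `a` on each component. -/
def rightMul (a : Smooth θ) : PreForms θ τ →L[ℂ] PreForms θ τ :=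
  boundedMap (LinearMap.mulRight ℂ a) ‖(a : Ambient θ)‖ (norm_nonneg _) (norm_vec_mul_le' a)

lemma PreForms.ext {x y : PreForms θ τ} (h1 : ∀ i, x.1 i = y.1 i) (h2 : ∀ i, x.2 i = y.2 i) :
    x = y := Prod.ext (funext h1) (funext h2)

lemma leftMul_fst (a : Smooth θ) (x : PreForms θ τ) (i : Fin 2) :
    (leftMul a x).1 i = a * x.1 i := rfl

lemma leftMul_snd (a : Smooth θ) (x : PreForms θ τ) (i : Fin 2) :
    (leftMul a x).2 i = a * x.2 i := rfl

lemma rightMul_fst (a : Smooth θ) (x : PreForms θ τ) (i : Fin 2) :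
    (rightMul a x).1 i = x.1 i * a := rfl

lemma rightMul_snd (a : Smooth θ) (x : PreForms θ τ) (i : Fin 2) :
    (rightMul a x).2 i = x.2 i * a := rfl

lemma completion_ext {S T : Forms θ τ →L[ℂ] Forms θ τ} (h : ∀ x : PreForms θ τ, S x = T x) :
    S = T := by
  ext x
  induction x using UniformSpace.Completion.induction_on with
  | hp => apply isClosed_eq <;> fun_prop
  | ih x => exact h x

/-- Left multiplication as a `*`-representation of `A_θ^∞` on the Hilbert space of forms. -/
def leftRep (θ : ℝ) (τ : UpperHalfPlane) : Smooth θ →⋆ₐ[ℂ] (Forms θ τ →L[ℂ] Forms θ τ) where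
  toFun a := (leftMul a).completion
  map_one' := completion_ext fun x => by
    have h : leftMul (τ := τ) (1 : Smooth θ) x = x :=
      PreForms.ext (fun _ => one_mul _) (fun _ => one_mul _)
    exact (ContinuousLinearMap.completion_apply_coe _ _).trans (congrArg _ h)
  map_mul' a b := completion_ext fun x => by
    have h : leftMul (τ := τ) (a * b) x = leftMul a (leftMul b x) :=
      PreForms.ext (fun _ => mul_assoc _ _ _) (fun _ => mul_assoc _ _ _)
    change _ = (leftMul a).completion ((leftMul b).completion (x : Forms θ τ))
    rw [ContinuousLinearMap.completion_apply_coe,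
      ContinuousLinearMap.completion_apply_coe, ContinuousLinearMap.completion_apply_coe, ← h]
  map_zero' := completion_ext fun x => by
    have h : leftMul (τ := τ) (0 : Smooth θ) x = 0 :=
      PreForms.ext (fun _ => zero_mul _) (fun _ => zero_mul _)
    exact (ContinuousLinearMap.completion_apply_coe _ _).trans (congrArg _ h)
  map_add' a b := completion_ext fun x => by
    have h : leftMul (τ := τ) (a + b) x = leftMul a x + leftMul b x :=
      PreForms.ext (fun _ => add_mul _ _ _) (fun _ => add_mul _ _ _)
    rw [add_apply, ContinuousLinearMap.completion_apply_coe,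
      ContinuousLinearMap.completion_apply_coe, ContinuousLinearMap.completion_apply_coe,
      ← UniformSpace.Completion.coe_add, ← h]
  commutes' r := completion_ext fun x => by
    have h : leftMul (τ := τ) (r • (1 : Smooth θ)) x = r • x :=
      PreForms.ext (fun _ => smul_one_mul _ _) (fun _ => smul_one_mul _ _)
    rw [Algebra.algebraMap_eq_smul_one, Algebra.algebraMap_eq_smul_one, smul_apply,
      ContinuousLinearMap.completion_apply_coe, one_apply_eq_self,
      ← UniformSpace.Completion.coe_smul, ← h]
  map_star' a := by
    refine (ContinuousLinearMap.eq_adjoint_iff _ _).2 fun x y => ?_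
    induction x, y using UniformSpace.Completion.induction_on₂ with
    | hp => apply isClosed_eq <;> fun_prop
    | ih x y =>
      rw [ContinuousLinearMap.completion_apply_coe, ContinuousLinearMap.completion_apply_coe,
        UniformSpace.Completion.inner_coe, UniformSpace.Completion.inner_coe, inner_def, inner_def]
      simp only [preInner, leftMul_fst, leftMul_snd, star_mul, star_star, mul_assoc]

/-- Right multiplication as a `*`-representation of the opposite algebra of `A_θ^∞` on the Hilbert
space of forms. -/
def rightRep (θ : ℝ) (τ : UpperHalfPlane) :
    (Smooth θ)ᵐᵒᵖ →⋆ₐ[ℂ] (Forms θ τ →L[ℂ] Forms θ τ) where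
  toFun a := (rightMul a.unop).completion
  map_one' := completion_ext fun x => by
    have h : rightMul (τ := τ) (1 : Smooth θ) x = x :=
      PreForms.ext (fun _ => mul_one _) (fun _ => mul_one _)
    exact (ContinuousLinearMap.completion_apply_coe _ _).trans (congrArg _ h)
  map_mul' a b := completion_ext fun x => by
    have h : rightMul (τ := τ) (b.unop * a.unop) x = rightMul a.unop (rightMul b.unop x) :=
      PreForms.ext (fun _ => (mul_assoc _ _ _).symm) (fun _ => (mul_assoc _ _ _).symm)
    change _ = (rightMul a.unop).completion ((rightMul b.unop).completion (x : Forms θ τ))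
    rw [ContinuousLinearMap.completion_apply_coe,
      ContinuousLinearMap.completion_apply_coe, ContinuousLinearMap.completion_apply_coe, ← h]
    rfl
  map_zero' := completion_ext fun x => by
    have h : rightMul (τ := τ) (0 : Smooth θ) x = 0 :=
      PreForms.ext (fun _ => mul_zero _) (fun _ => mul_zero _)
    exact (ContinuousLinearMap.completion_apply_coe _ _).trans (congrArg _ h)
  map_add' a b := completion_ext fun x => by
    have h : rightMul (τ := τ) (a.unop + b.unop) x = rightMul a.unop x + rightMul b.unop x :=
      PreForms.ext (fun _ => mul_add _ _ _) (fun _ => mul_add _ _ _)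
    rw [add_apply, ContinuousLinearMap.completion_apply_coe,
      ContinuousLinearMap.completion_apply_coe, ContinuousLinearMap.completion_apply_coe,
      ← UniformSpace.Completion.coe_add, ← h]
    rfl
  commutes' r := completion_ext fun x => by
    have h : rightMul (τ := τ) (r • (1 : Smooth θ)) x = r • x :=
      PreForms.ext (fun _ => mul_smul_one _ _) (fun _ => mul_smul_one _ _)
    rw [Algebra.algebraMap_eq_smul_one, Algebra.algebraMap_eq_smul_one, smul_apply,
      ContinuousLinearMap.completion_apply_coe, one_apply_eq_self,
      ← UniformSpace.Completion.coe_smul, ← h]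
    rfl
  map_star' a := by
    have key : ∀ b c : Smooth θ, tr (star (b * star a.unop) * c) = tr (star b * (c * a.unop)) :=
      fun b c => by rw [star_mul, star_star, mul_assoc, tr_mul_comm, mul_assoc]
    refine (ContinuousLinearMap.eq_adjoint_iff _ _).2 fun x y => ?_
    induction x, y using UniformSpace.Completion.induction_on₂ with
    | hp => apply isClosed_eq <;> fun_prop
    | ih x y =>
      rw [ContinuousLinearMap.completion_apply_coe, ContinuousLinearMap.completion_apply_coe,
        UniformSpace.Completion.inner_coe, UniformSpace.Completion.inner_coe, inner_def, inner_def]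
      simp only [preInner, rightMul_fst, rightMul_snd, MulOpposite.unop_star, key]

/-- The operator given by a `2 × 2` matrix of operators on `A_θ^∞`. -/
def ofBlocks (M : Matrix (Fin 2) (Fin 2) (Module.End ℂ (Smooth θ))) :
    (Fin 2 → Smooth θ) →ₗ[ℂ] (Fin 2 → Smooth θ) :=
  LinearMap.pi fun i => ∑ j, M i j ∘ₗ LinearMap.proj j

open Complex in
/-- The operator `d = d₀ + d₁*` from `H^+` to `H^-` on smooth elements. -/
def d (θ : ℝ) (τ : UpperHalfPlane) : (Fin 2 → Smooth θ) →ₗ[ℂ] (Fin 2 → Smooth θ) :=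
  ofBlocks
    !![I • δ₁, (I * normSq τ) • δ₂ + (I * τ.re) • δ₁;
       I • δ₂, -(I * τ.re) • δ₂ - I • δ₁]

open Complex in
/-- The operator `d* = d₀* + d₁` from `H^-` to `H^+` on smooth elements. -/
def dStar (θ : ℝ) (τ : UpperHalfPlane) : (Fin 2 → Smooth θ) →ₗ[ℂ] (Fin 2 → Smooth θ) :=
  ofBlocks
    !![-I • δ₁ - (I * τ.re) • δ₂, -(I * τ.re) • δ₁ - (I * normSq τ) • δ₂;
       -I • δ₂, I • δ₁]

/-- The Weyl factor `k = e^{h/2}`, an invertible element of `A_θ^∞`. -/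
def weyl (h : Smooth θ) : (Smooth θ)ˣ where
  val := ⟨NormedSpace.exp (((1 / 2 : ℂ) • h : Smooth θ) : Ambient θ), exp_mem_smooth _⟩
  inv := ⟨NormedSpace.exp ((-((1 / 2 : ℂ) • h) : Smooth θ) : Ambient θ), exp_mem_smooth _⟩
  val_inv := by
    let _ : NormedAlgebra ℚ (Ambient θ) := NormedAlgebra.restrictScalars ℚ ℂ _
    apply Subtype.ext
    change NormedSpace.exp (((1 / 2 : ℂ) • h : Smooth θ) : Ambient θ) *
      NormedSpace.exp (-(((1 / 2 : ℂ) • h : Smooth θ) : Ambient θ)) = 1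
    rw [← NormedSpace.exp_add_of_commute (Commute.refl _).neg_right, add_neg_cancel,
      NormedSpace.exp_zero]
  inv_val := by
    let _ : NormedAlgebra ℚ (Ambient θ) := NormedAlgebra.restrictScalars ℚ ℂ _
    apply Subtype.ext
    change NormedSpace.exp (-(((1 / 2 : ℂ) • h : Smooth θ) : Ambient θ)) *
      NormedSpace.exp (((1 / 2 : ℂ) • h : Smooth θ) : Ambient θ) = 1
    rw [← NormedSpace.exp_add_of_commute (Commute.refl _).neg_left, neg_add_cancel,
      NormedSpace.exp_zero]

/-- On smooth forms, the operator with matrix `(0, R_k ∘ d*; d ∘ R_k, 0)` with respect to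
`H = H^+ ⊕ H^-`, where `R_k` is right multiplication by `k`. -/
def DTildeCore (h : Smooth θ) : PreForms θ τ →ₗ[ℂ] PreForms θ τ where
  toFun x := (entrywise (LinearMap.mulRight ℂ (weyl h : Smooth θ)) (dStar θ τ x.2),
    d θ τ (entrywise (LinearMap.mulRight ℂ (weyl h : Smooth θ)) x.1))
  map_add' x y := by
    have h1 : (x + y).1 = x.1 + y.1 := rfl
    have h2 : (x + y).2 = x.2 + y.2 := rfl
    rw [h1, h2]; simp only [map_add]; rfl
  map_smul' c x := by
    have h1 : (c • x).1 = c • x.1 := rfl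
    have h2 : (c • x).2 = c • x.2 := rfl
    rw [h1, h2]; simp only [map_smul]; rfl

/-- On smooth forms, the operator with matrix `(0, k d; d* k, 0)`, where `k` acts by left
multiplication. As `d` maps `H^+` to `H^-`, this matrix is written with respect to `H = H^- ⊕ H^+`. -/
def DBarCore (h : Smooth θ) : PreForms θ τ →ₗ[ℂ] PreForms θ τ where
  toFun x := (dStar θ τ (entrywise (LinearMap.mulLeft ℂ (weyl h : Smooth θ)) x.2),
    entrywise (LinearMap.mulLeft ℂ (weyl h : Smooth θ)) (d θ τ x.1))
  map_add' x y := by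
    have h1 : (x + y).1 = x.1 + y.1 := rfl
    have h2 : (x + y).2 = x.2 + y.2 := rfl
    rw [h1, h2]; simp only [map_add]; rfl
  map_smul' c x := by
    have h1 : (c • x).1 = c • x.1 := rfl
    have h2 : (c • x).2 = c • x.2 := rfl
    rw [h1, h2]; simp only [map_smul]; rfl

/-- The closed operator with core the smooth forms: its graph is the closure of the graph of `T`. -/
def closedOp (T : PreForms θ τ →ₗ[ℂ] PreForms θ τ) : Forms θ τ →ₗ.[ℂ] Forms θ τ :=
  (LinearMap.range (LinearMap.prod
    (UniformSpace.Completion.toComplₗᵢ (𝕜 := ℂ) (E := PreForms θ τ)).toLinearMap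
    ((UniformSpace.Completion.toComplₗᵢ (𝕜 := ℂ) (E := PreForms θ τ)).toLinearMap ∘ₗ T))
    ).topologicalClosure.toLinearPMap

/-- The inner automorphism `a ↦ k a k⁻¹`. -/
def conj {A : Type*} [Ring A] [Algebra ℂ A] (k : Aˣ) : A ≃ₐ[ℂ] A where
  toFun a := k * a * ↑k⁻¹
  invFun a := ↑k⁻¹ * a * k
  left_inv a := by simp [mul_assoc]
  right_inv a := by simp [mul_assoc]
  map_mul' a b := by simp [mul_assoc]
  map_add' a b := by simp [mul_add, add_mul]
  commutes' r := by rw [← Algebra.commutes, mul_assoc, Units.mul_inv, mul_one]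

/-- The triple over the opposite algebra of `A_θ^∞` acting by right multiplication, with the operator
`D̃_h = (0, R_k ∘ d*; d ∘ R_k, 0)` and the automorphism `a^op ↦ (k⁻¹ a k)^op`. -/
def tildeTriple (θ : ℝ) (τ : UpperHalfPlane) (h : Smooth θ) :
    TwistedTriple (Smooth θ)ᵐᵒᵖ (Forms θ τ) where
  rep := rightRep θ τ
  dirac := closedOp (DTildeCore h)
  twist := AlgEquiv.op (conj (weyl h)⁻¹)

/-- The perturbed triple over `A_θ^∞` acting by left multiplication, with the operator
`D̄_h = (0, k d; d* k, 0)` and the automorphism `a ↦ k a k⁻¹`. -/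
def barTriple (θ : ℝ) (τ : UpperHalfPlane) (h : Smooth θ) :
    TwistedTriple (Smooth θ) (Forms θ τ) where
  rep := leftRep θ τ
  dirac := closedOp (DBarCore h)
  twist := conj (weyl h)

end Forms

end NCTorus

end

/-! Both perturbed operators have the form S D S, where D = d + d* (`diracCore`) and S is bounded,
symmetric and boundedly invertible. For D̃_h, S is right multiplication by k on even forms and the
identity on odd forms (`evenRight`). For D̄_h, it is the identity on even forms and left
multiplication by k on odd forms (`oddLeft`). Symmetry uses k* = k and, for right multiplication,
that φ is a trace. Self-adjointness and compactness pass from D to S D S (`adjoint_sandwich`,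
`isCompactOperator_fst_sandwich`), so the analysis concerns D alone.

Put P = δ₁ + Re τ δ₂, Q = Im τ δ₂ and N = (P, Q; Q, -P). In an orthonormal frame, d is iN and d* is
-iN, so D² acts on frame vectors with entry U^m V^n as the scalar |m + τn|². These vectors form a
Hilbert basis (`formsBasis`) inside the smooth forms. Since (D ± i)(D ∓ i) = D² + 1 has nonzero
eigenvalues on them, D ± i have dense range and the closure of D is self-adjoint
(`adjoint_closedGraph_eq`). Since |m + τn|² tends to infinity, the projection of the graph to the
Hilbert space is a norm limit of finite rank maps, hence compact
(`isCompactOperator_fst_closedGraph`), and every resolvent factors through it.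

The entries of d and d* are combinations of derivations, so their commutators with multiplications
are bounded. The twist by k is exactly what reduces D̃_h a - σ(a) D̃_h and D̄_h a - σ(a) D̄_h to
such commutators, composed with multiplication by k.

For the transpose, the Riesz map identifies the dual with the conjugate space and turns the
transpose of a self-adjoint operator into the operator itself (`mem_graph_transposePMap`). It
remains to find an antiunitary J with J D̄_h = D̃_h J and J L_a = R_{a*} J. The involution supplies
the passage from left to right, and an exchange of even and odd forms matches the positions of k. In
the frame, J sends (c₀, c₁, c₂, c₃) to (c₂*, c₃*, -c₀*, -c₁*) (`starSwap`); the signs make it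
commute with D. The unitary sought is J followed by the Riesz map. -/

noncomputable section

/-! ### Self-adjoint linear relations and their resolvents -/

namespace ModularTriple

section Relation

variable {H : Type*} [NormedAddCommGroup H] [InnerProductSpace ℂ H]

lemma mem_adjoint_iff_inner_eq {G : Submodule ℂ (H × H)} {p : H × H} :
    p ∈ G.adjoint ↔ ∀ q ∈ G, ⟪q.2, p.1⟫_ℂ = ⟪q.1, p.2⟫_ℂ := by
  rw [Submodule.mem_adjoint_iff]
  exact ⟨fun h q hq => sub_eq_zero.1 (h q.1 q.2 hq), fun h a b hab => sub_eq_zero.2 (h _ hab)⟩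

lemma inner_eq_of_le_adjoint {G : Submodule ℂ (H × H)} (hG : G ≤ G.adjoint) {p q : H × H}
    (hp : p ∈ G) (hq : q ∈ G) : ⟪p.2, q.1⟫_ℂ = ⟪p.1, q.2⟫_ℂ :=
  mem_adjoint_iff_inner_eq.1 (hG hq) p hp

/-- The cross term is the real part of i⟪y, x⟫, which vanishes because ⟪y, x⟫ is real. For a
symmetric relation this is the a priori estimate: y - i x controls the graph norm. -/
lemma norm_sq_sub_I_smul {x y : H} (h : ⟪y, x⟫_ℂ = ⟪x, y⟫_ℂ) :
    ‖y - Complex.I • x‖ ^ 2 = ‖y‖ ^ 2 + ‖x‖ ^ 2 := by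
  have him : (⟪y, x⟫_ℂ).im = 0 := by
    exact Complex.conj_eq_iff_im.1 (by rw [inner_conj_symm, h])
  rw [@norm_sub_sq ℂ, inner_smul_right, norm_smul]
  simp [him]

/-- A symmetric closed relation `G` for which the range of `y - i x`, `(x, y) ∈ G`, is dense is
isomorphic to the whole space through this map. -/
lemma exists_equiv_sub_I_smul [CompleteSpace H] {G : Submodule ℂ (H × H)} (hcl : IsClosed (G : Set (H × H)))
    (hG : G ≤ G.adjoint)
    (hd : ∀ z : H, (∀ p ∈ G, ⟪p.2 - Complex.I • p.1, z⟫_ℂ = 0) → z = 0) :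
    ∃ e : G ≃L[ℂ] H, ∀ p : G, e p = (p : H × H).2 - Complex.I • (p : H × H).1 := by
  have : CompleteSpace G := hcl.completeSpace_coe
  let f : G →L[ℂ] H := (ContinuousLinearMap.snd ℂ H H - Complex.I • ContinuousLinearMap.fst ℂ H H) ∘L
    G.subtypeL
  have hf : ∀ p : G, f p = (p : H × H).2 - Complex.I • (p : H × H).1 := fun p => rfl
  have hbij : Function.Bijective f := by
    rw [ContinuousLinearMap.bijective_iff_dense_range_and_antilipschitz]
    constructor
    -- The range is dense because its orthogonal complement is trivial by `hd`.
    · rw [Submodule.topologicalClosure_eq_top_iff, Submodule.eq_bot_iff]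
      intro z hz
      refine hd z fun p hp => ?_
      exact (Submodule.mem_orthogonal _ _).1 hz _ ⟨⟨p, hp⟩, rfl⟩
    · refine ⟨1, f.antilipschitz_of_bound fun p => ?_⟩
      have h1 := norm_sq_sub_I_smul (inner_eq_of_le_adjoint hG p.2 p.2)
      rw [NNReal.coe_one, one_mul, hf]
      -- The product carries the maximum norm, so the Pythagorean identity gives the lower bound
      -- with constant 1.
      change max ‖(p : H × H).1‖ ‖(p : H × H).2‖ ≤ _
      refine max_le ?_ ?_ <;> refine abs_le_of_sq_le_sq' ?_ (norm_nonneg _) |>.2 <;>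
        nlinarith [sq_nonneg ‖(p : H × H).1‖, sq_nonneg ‖(p : H × H).2‖]
  refine ⟨ContinuousLinearEquiv.ofBijective f (LinearMap.ker_eq_bot.2 hbij.1)
    (LinearMap.range_eq_top.2 hbij.2), fun p => rfl⟩

/-- The orthogonality says that (z, -i z) lies in the adjoint, hence in G. Testing z against this
very pair gives 2i⟪z, z⟫ = 0. -/
lemma eq_zero_of_sub_I_smul_orthogonal {G : Submodule ℂ (H × H)} (hG : G.adjoint = G) {z : H}
    (hz : ∀ p ∈ G, ⟪p.2 - Complex.I • p.1, z⟫_ℂ = 0) : z = 0 := by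
  have hmem : (z, -Complex.I • z) ∈ G := by
    rw [← hG, mem_adjoint_iff_inner_eq]
    intro q hq
    have := hz q hq
    rw [inner_sub_left, inner_smul_left, sub_eq_zero, Complex.conj_I] at this
    rw [inner_smul_right]
    exact this
  have h := hz _ hmem
  rw [neg_smul, inner_sub_left, inner_neg_left, inner_smul_left, Complex.conj_I] at h
  have h2 : ⟪z, z⟫_ℂ = 0 := by
    have : (2 * Complex.I) * ⟪z, z⟫_ℂ = 0 := by linear_combination h
    exact (mul_eq_zero.1 this).resolve_left (by simp)
  exact inner_self_eq_zero.1 h2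

/-- The basic criterion for self-adjointness. -/
lemma adjoint_eq_of_dense_range [CompleteSpace H] {G : Submodule ℂ (H × H)} (hcl : IsClosed (G : Set (H × H)))
    (hG : G ≤ G.adjoint)
    (hd : ∀ z : H, (∀ p ∈ G, ⟪p.2 - Complex.I • p.1, z⟫_ℂ = 0) → z = 0)
    (hd' : ∀ z : H, (∀ p ∈ G, ⟪p.2 + Complex.I • p.1, z⟫_ℂ = 0) → z = 0) :
    G.adjoint = G := by
  refine le_antisymm (fun p hp => ?_) hG
  obtain ⟨e, he⟩ := exists_equiv_sub_I_smul hcl hG hd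
  -- Choose q in G with the same value of y - i x as p. The difference is then a pair (w, i w) in
  -- the adjoint, and such a w is orthogonal to all y + i x, so it vanishes by `hd'`.
  obtain ⟨q, hq⟩ := e.surjective (p.2 - Complex.I • p.1)
  rw [he] at hq
  have hr : p - q ∈ G.adjoint := sub_mem hp (hG q.2)
  have h2 : (p - q).2 = Complex.I • (p - q).1 := by
    rw [Prod.snd_sub, Prod.fst_sub, smul_sub]
    have := sub_eq_sub_iff_sub_eq_sub.1 hq
    rw [← neg_inj, neg_sub, neg_sub]
    exact this
  have h1 : (p - q).1 = 0 := by
    refine hd' _ fun r hrG => ?_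
    have := mem_adjoint_iff_inner_eq.1 hr r hrG
    rw [h2, inner_smul_right] at this
    rw [inner_add_left, inner_smul_left, this, Complex.conj_I]
    ring
  have h0 : p - q = 0 := Prod.ext h1 (by rw [h2, h1]; simp)
  rw [sub_eq_zero.1 h0]
  exact q.2

/-- A pair (0, y) in a symmetric relation has y orthogonal to the domain. Single-valuedness is what
guarantees that `Submodule.toLinearPMap` has G as its graph. -/
lemma snd_eq_zero_of_dense {G : Submodule ℂ (H × H)} (hG : G ≤ G.adjoint)
    (hd : Dense (G.map (LinearMap.fst ℂ H H) : Set H)) :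
    ∀ p ∈ G, p.1 = 0 → p.2 = 0 := by
  intro p hp h0
  refine hd.eq_zero_of_inner_right ℂ ?_
  rintro _ ⟨q, hq, rfl⟩
  have := inner_eq_of_le_adjoint hG hq hp
  rw [h0, inner_zero_right] at this
  exact this.symm

lemma isSelfAdjoint_toLinearPMap [CompleteSpace H] {G : Submodule ℂ (H × H)} (hG : G.adjoint = G)
    (hd : Dense (G.map (LinearMap.fst ℂ H H) : Set H)) : IsSelfAdjoint G.toLinearPMap := by
  rw [LinearPMap.isSelfAdjoint_def]
  apply LinearPMap.eq_of_eq_graph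
  rw [LinearPMap.adjoint_graph_eq_graph_adjoint (T := G.toLinearPMap) hd,
    Submodule.toLinearPMap_graph_eq _ (snd_eq_zero_of_dense hG.ge hd), hG]

lemma hasCompactResolvent_toLinearPMap [CompleteSpace H] {G : Submodule ℂ (H × H)}
    (hcl : IsClosed (G : Set (H × H))) (hG : G.adjoint = G)
    (hd : Dense (G.map (LinearMap.fst ℂ H H) : Set H))
    (hc : IsCompactOperator fun p : G => (p : H × H).1) :
    HasCompactResolvent G.toLinearPMap := by
  have hgr := Submodule.toLinearPMap_graph_eq _ (snd_eq_zero_of_dense hG.ge hd)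
  have hmem : ∀ x : G.toLinearPMap.domain, ((x : H), G.toLinearPMap x) ∈ G := fun x =>
    hgr.le (LinearPMap.mem_graph _ x)
  constructor
  -- The resolvent at i inverts (x, y) ↦ y - i x on the graph and then takes the first component.
  · obtain ⟨e, he⟩ := exists_equiv_sub_I_smul hcl hG.ge
      fun z hz => eq_zero_of_sub_I_smul_orthogonal hG hz
    refine ⟨Complex.I, ContinuousLinearMap.fst ℂ H H ∘L G.subtypeL ∘L e.symm.toContinuousLinearMap,
      fun x => ?_, fun y => ?_⟩
    · have : e ⟨((x : H), G.toLinearPMap x), hmem x⟩ = G.toLinearPMap x - Complex.I • (x : H) := he _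
      rw [← this]
      simp
    · have hg : (e.symm y : H × H) ∈ G.toLinearPMap.graph := hgr.ge (e.symm y).2
      rw [LinearPMap.mem_graph_iff] at hg
      obtain ⟨x, hx1, hx2⟩ := hg
      have hdom : (e.symm y : H × H).1 ∈ G.toLinearPMap.domain := hx1 ▸ x.2
      refine ⟨hdom, ?_⟩
      have hx : x = ⟨(e.symm y : H × H).1, hdom⟩ := Subtype.ext hx1
      change G.toLinearPMap ⟨(e.symm y : H × H).1, hdom⟩ - Complex.I • (e.symm y : H × H).1 = y
      rw [← hx, hx2, ← he, e.apply_symm_apply]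
  · intro z R hR
    have hmem' : ∀ y, (R y, y + z • R y) ∈ G := fun y => by
      obtain ⟨hy, hy'⟩ := hR.2 y
      have := hmem ⟨R y, hy⟩
      rwa [sub_eq_iff_eq_add.1 hy'] at this
    -- Any resolvent factors as y ↦ (R y, y + z R y) into G, followed by the compact first
    -- projection.
    let F : H →L[ℂ] G := (R.prod (ContinuousLinearMap.id ℂ H + z • R)).codRestrict G hmem'
    exact hc.comp_clm F

/-- The relation `S G S` for a bounded invertible operator `S`. -/
def sandwich (S : H ≃L[ℂ] H) (G : Submodule ℂ (H × H)) : Submodule ℂ (H × H) :=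
  G.comap (LinearMap.prodMap S.toLinearMap S.symm.toLinearMap)

lemma mem_sandwich {S : H ≃L[ℂ] H} {G : Submodule ℂ (H × H)} {p : H × H} :
    p ∈ sandwich S G ↔ (S p.1, S.symm p.2) ∈ G := Iff.rfl

lemma isClosed_sandwich (S : H ≃L[ℂ] H) {G : Submodule ℂ (H × H)}
    (hcl : IsClosed (G : Set (H × H))) : IsClosed (sandwich S G : Set (H × H)) :=
  hcl.preimage (f := fun p : H × H => (S p.1, S.symm p.2)) (by fun_prop)

/-- S and its inverse are both symmetric, so they can be moved across the inner products, and (x, y)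
lies in the adjoint exactly when (S x, S⁻¹ y) lies in the adjoint of G. As S is bounded and
invertible, no domain question arises. -/
lemma adjoint_sandwich (S : H ≃L[ℂ] H) (hS : ∀ x y, ⟪S x, y⟫_ℂ = ⟪x, S y⟫_ℂ)
    {G : Submodule ℂ (H × H)} (hG : G.adjoint = G) :
    (sandwich S G).adjoint = sandwich S G := by
  have hS' : ∀ x y, ⟪S.symm x, y⟫_ℂ = ⟪x, S.symm y⟫_ℂ := fun x y => by
    conv_lhs => rw [← S.apply_symm_apply y, ← hS, S.apply_symm_apply]
  ext p
  rw [mem_sandwich, mem_adjoint_iff_inner_eq]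
  conv_rhs => rw [← hG, mem_adjoint_iff_inner_eq]
  constructor
  · intro h q hq
    have := h (S.symm q.1, S q.2) (by rw [mem_sandwich]; simpa using hq)
    rwa [hS, hS'] at this
  · intro h q hq
    have := h _ (mem_sandwich.1 hq)
    dsimp only at this
    rwa [← hS, ← hS', S.apply_symm_apply, S.symm_apply_apply] at this

lemma isCompactOperator_fst_sandwich (S : H ≃L[ℂ] H) {G : Submodule ℂ (H × H)}
    (hc : IsCompactOperator fun p : G => (p : H × H).1) :
    IsCompactOperator fun p : sandwich S G => (p : H × H).1 := by
  let F : sandwich S G →L[ℂ] G :=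
    ((S.toContinuousLinearMap.prodMap S.symm.toContinuousLinearMap) ∘L
      (sandwich S G).subtypeL).codRestrict G fun p => mem_sandwich.1 p.2
  -- The first projection of the sandwich is S⁻¹ after the first projection of G after (x, y) ↦ (S
  -- x, S⁻¹ y).
  have h := (hc.comp_clm F).clm_comp S.symm.toContinuousLinearMap
  exact (funext fun p => S.symm_apply_apply _ :
    (S.symm ∘ (fun p : G => (p : H × H).1) ∘ F) = fun p : sandwich S G => (p : H × H).1) ▸ h

end Relation

end ModularTriple

/-! ### Closures of operators given on a dense core -/

namespace ModularTriple

open UniformSpace (Completion)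
open Filter Topology

section ClosedGraph

variable {E : Type*} [SeminormedAddCommGroup E] [InnerProductSpace ℂ E]

/-- The closure in the completion of the graph of an operator `T`. -/
def closedGraph (T : E →ₗ[ℂ] E) : Submodule ℂ (Completion E × Completion E) :=
  (LinearMap.range (LinearMap.prod
    (Completion.toComplₗᵢ (𝕜 := ℂ) (E := E)).toLinearMap
    ((Completion.toComplₗᵢ (𝕜 := ℂ) (E := E)).toLinearMap ∘ₗ T))).topologicalClosure

lemma isClosed_closedGraph (T : E →ₗ[ℂ] E) :
    IsClosed (closedGraph T : Set (Completion E × Completion E)) :=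
  Submodule.isClosed_topologicalClosure _

lemma coe_mem_closedGraph (T : E →ₗ[ℂ] E) (x : E) :
    ((x : Completion E), ((T x : E) : Completion E)) ∈ closedGraph T :=
  Submodule.le_topologicalClosure _ ⟨x, rfl⟩

/-- The device that carries identities and estimates from the core to the closed operator: a closed
condition need only be checked on the graph over the core. -/
lemma closedGraph_induction {T : E →ₗ[ℂ] E} {P : Completion E × Completion E → Prop}
    (hP : IsClosed {p | P p}) (h : ∀ x : E, P ((x : Completion E), ((T x : E) : Completion E)))
    {p : Completion E × Completion E} (hp : p ∈ closedGraph T) : P p := by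
  refine closure_minimal (t := {p | P p}) ?_ hP hp
  rintro _ ⟨x, rfl⟩
  exact h x

lemma dense_map_fst_closedGraph (T : E →ₗ[ℂ] E) :
    Dense ((closedGraph T).map (LinearMap.fst ℂ _ _) : Set (Completion E)) := by
  refine Completion.denseRange_coe.mono ?_
  rintro _ ⟨x, rfl⟩
  exact ⟨_, coe_mem_closedGraph T x, rfl⟩

lemma mem_adjoint_closedGraph {T : E →ₗ[ℂ] E} {p : Completion E × Completion E}
    (h : ∀ x : E, ⟪((T x : E) : Completion E), p.1⟫_ℂ = ⟪(x : Completion E), p.2⟫_ℂ) :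
    p ∈ (closedGraph T).adjoint := by
  rw [mem_adjoint_iff_inner_eq]
  intro q hq
  exact closedGraph_induction (P := fun q => ⟪q.2, p.1⟫_ℂ = ⟪q.1, p.2⟫_ℂ)
    (isClosed_eq (by fun_prop) (by fun_prop)) h hq

lemma closedGraph_le_adjoint {T : E →ₗ[ℂ] E} (hT : ∀ x y, ⟪T x, y⟫_ℂ = ⟪x, T y⟫_ℂ) :
    closedGraph T ≤ (closedGraph T).adjoint := by
  intro p hp
  refine mem_adjoint_closedGraph fun x => ?_
  refine closedGraph_induction
    (P := fun p => ⟪((T x : E) : Completion E), p.1⟫_ℂ = ⟪(x : Completion E), p.2⟫_ℂ)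
    (isClosed_eq (by fun_prop) (by fun_prop)) (fun y => ?_) hp
  simp only [Completion.inner_coe, hT]

section Basis

variable {ι : Type*} {T : E →ₗ[ℂ] E} {b : ι → E} {μ : ι → ℝ} {B : HilbertBasis ι ℂ (Completion E)}

/-- Eigenvectors of T² suffice, and none of T are needed: for c = ±i one has (T + c)(T - c) b = (μ +
1) b, so the ranges of T ± i contain a nonzero multiple of every basis vector. -/
lemma adjoint_closedGraph_eq (hT : ∀ x y, ⟪T x, y⟫_ℂ = ⟪x, T y⟫_ℂ) (hB : ∀ i, B i = b i)
    (hb : ∀ i, T (T (b i)) = (μ i : ℂ) • b i) (hμ : ∀ i, 0 ≤ μ i) :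
    (closedGraph T).adjoint = closedGraph T := by
  have key : ∀ c : ℂ, c * c = -1 → ∀ z : Completion E,
      (∀ p ∈ closedGraph T, ⟪p.2 + c • p.1, z⟫_ℂ = 0) → z = 0 := by
    intro c hc z hz
    refine B.repr.map_eq_zero_iff.1 (lp.ext (funext fun i => ?_))
    rw [B.repr_apply_apply]
    change _ = (0 : ℂ)
    -- The test vector (T - c) b_i is chosen so that T + c sends it to (μ_i + 1) b_i.
    have h1 := hz _ (coe_mem_closedGraph T (T (b i) - c • b i))
    dsimp only at h1
    have h2 : T (T (b i) - c • b i) + c • (T (b i) - c • b i) = ((μ i + 1 : ℝ) : ℂ) • b i := by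
      rw [map_sub, map_smul, hb, smul_sub, smul_smul, hc]
      push_cast
      module
    rw [← Completion.coe_smul, ← Completion.coe_add, h2, Completion.coe_smul, inner_smul_left,
      ← hB] at h1
    refine (mul_eq_zero.1 h1).resolve_left ?_
    rw [Complex.conj_ofReal, Complex.ofReal_eq_zero]
    linarith [hμ i]
  refine adjoint_eq_of_dense_range (isClosed_closedGraph T) (closedGraph_le_adjoint hT) ?_ ?_
  · intro z hz
    refine key (-Complex.I) (by simp) z fun p hp => ?_
    rw [neg_smul, ← sub_eq_add_neg]
    exact hz p hp
  · exact key Complex.I (by simp)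

/-- By Parseval, ‖v‖² is the sum of the |⟪b_i, v⟫|², while ‖T v‖² = ⟪v, T² v⟫ is the sum of the μ_i
|⟪b_i, v⟫|². Removing the part over F leaves only coefficients with μ_i ≥ M. Both sides are
continuous on the graph, so the core suffices. -/
lemma mul_norm_sq_sub_sum_le (hT : ∀ x y, ⟪T x, y⟫_ℂ = ⟪x, T y⟫_ℂ) (hB : ∀ i, B i = b i)
    (hb : ∀ i, T (T (b i)) = (μ i : ℂ) • b i) (hμ : ∀ i, 0 ≤ μ i) {M : ℝ} {F : Finset ι}
    (hF : ∀ i ∉ F, M ≤ μ i) {p : Completion E × Completion E} (hp : p ∈ closedGraph T) :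
    M * ‖p.1 - ∑ i ∈ F, ⟪B i, p.1⟫_ℂ • B i‖ ^ 2 ≤ ‖p.2‖ ^ 2 := by
  classical
  refine closedGraph_induction
    (P := fun p => M * ‖p.1 - ∑ i ∈ F, ⟪B i, p.1⟫_ℂ • B i‖ ^ 2 ≤ ‖p.2‖ ^ 2)
    (isClosed_le (by fun_prop) (by fun_prop)) (fun v => ?_) hp
  have hsum : ∀ x : Completion E, HasSum (fun i => ‖⟪B i, x⟫_ℂ‖ ^ 2) (‖x‖ ^ 2) := fun x => by
    have := (B.hasSum_inner_mul_inner x x).mapL Complex.reCLM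
    convert this using 1
    · funext i
      rw [← inner_conj_symm x, Complex.conj_mul']
      simp [← Complex.ofReal_pow]
    · exact norm_sq_eq_re_inner (𝕜 := ℂ) x
  have h1 : HasSum (fun i => μ i * ‖⟪B i, (v : Completion E)⟫_ℂ‖ ^ 2)
      (‖((T v : E) : Completion E)‖ ^ 2) := by
    -- Parseval for the pair v, T² v; symmetry moves T² onto the basis vector, where it becomes μ_i.
    have := (B.hasSum_inner_mul_inner (v : Completion E) ((T (T v) : E) : Completion E)).mapL
      Complex.reCLM
    convert this using 1
    · funext i
      rw [hB, Completion.inner_coe (b i) (T (T v)), ← hT, ← hT, hb, inner_smul_left,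
        Complex.conj_ofReal, mul_left_comm, Completion.inner_coe, Completion.inner_coe,
        ← inner_conj_symm v, Complex.conj_mul']
      simp [← Complex.ofReal_pow]
    · rw [Completion.inner_coe, ← hT, Completion.norm_coe]
      exact norm_sq_eq_re_inner (𝕜 := ℂ) _
  have hco : ∀ i, ⟪B i, (v : Completion E) - ∑ i ∈ F, ⟪B i, (v : Completion E)⟫_ℂ • B i⟫_ℂ =
      if i ∈ F then 0 else ⟪B i, (v : Completion E)⟫_ℂ := fun i => by
    have ho := orthonormal_iff_ite.1 B.orthonormal
    simp only [inner_sub_right, inner_sum, inner_smul_right, ho, mul_ite, mul_one, mul_zero,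
      Finset.sum_ite_eq]
    split_ifs <;> simp
  refine hasSum_le (fun i => ?_) ((hsum _).mul_left M) h1
  rw [hco]
  split_ifs with hi
  · simpa using mul_nonneg (hμ i) (sq_nonneg _)
  · exact mul_le_mul_of_nonneg_right (hF i hi) (sq_nonneg _)

/-- The truncations to finitely many basis vectors have finite rank. By `mul_norm_sq_sub_sum_le`
they converge to the first projection in operator norm for the graph norm. -/
lemma isCompactOperator_fst_closedGraph (hT : ∀ x y, ⟪T x, y⟫_ℂ = ⟪x, T y⟫_ℂ)
    (hB : ∀ i, B i = b i) (hb : ∀ i, T (T (b i)) = (μ i : ℂ) • b i) (hμ : ∀ i, 0 ≤ μ i)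
    (hμ' : Tendsto μ cofinite atTop) :
    IsCompactOperator fun p : closedGraph T => (p : Completion E × Completion E).1 := by
  classical
  let P : Finset ι → Completion E →L[ℂ] Completion E := fun F =>
    ∑ i ∈ F, (innerSL ℂ (B i)).smulRight (B i)
  let f : closedGraph T →L[ℂ] Completion E :=
    ContinuousLinearMap.fst ℂ _ _ ∘L (closedGraph T).subtypeL
  have hP : ∀ F, IsCompactOperator (P F) := fun F =>
    Submodule.sum_mem (compactOperator (RingHom.id ℂ) (Completion E) (Completion E)) fun i _ =>
      (isCompactOperator_of_locallyCompactSpace_dom (innerSL ℂ (B i))).clm_comp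
        ((ContinuousLinearMap.id ℂ ℂ).smulRight (B i))
  have hPa : ∀ F x, P F x = ∑ i ∈ F, ⟪B i, x⟫_ℂ • B i := fun F x => by
    simp [P]
  have hlim : Tendsto (fun F => P F ∘L f) atTop (𝓝 f) := by
    refine (Metric.tendsto_atTop (β := Finset ι) (u := fun F => P F ∘L f)).2 fun ε hε => ?_
    -- With M = (2/ε)², the estimate reads (2/ε)‖x - P_F x‖ ≤ ‖y‖, so the operator norm of the error
    -- is at most ε/2, strictly below ε.
    have hfin : {i | ¬ (2 / ε) ^ 2 ≤ μ i}.Finite := hμ'.eventually (eventually_ge_atTop _)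
    refine ⟨hfin.toFinset, fun F hF => ?_⟩
    rw [dist_comm]
    refine (dist_eq_norm f (P F ∘L f)).trans_lt ?_
    refine lt_of_le_of_lt (ContinuousLinearMap.opNorm_le_bound _ (half_pos hε).le fun p => ?_)
      (half_lt_self hε)
    have h1 := mul_norm_sq_sub_sum_le hT hB hb hμ (M := (2 / ε) ^ 2) (F := F) (fun i hi => by
      by_contra h
      exact hi (hF (hfin.mem_toFinset.2 h))) p.2
    rw [← hPa, ← mul_pow] at h1
    have h2 := abs_le_of_sq_le_sq' h1 (norm_nonneg _) |>.2
    have h3 : ‖(p : Completion E × Completion E).2‖ ≤ ‖p‖ := norm_snd_le (p : Completion E × Completion E)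
    change ‖(p : Completion E × Completion E).1 - P F (p : Completion E × Completion E).1‖ ≤ _
    rw [div_mul_eq_mul_div, div_le_iff₀ hε] at h2
    linarith [mul_le_mul_of_nonneg_left h3 hε.le]
  exact isCompactOperator_of_tendsto hlim (Eventually.of_forall fun F => (hP F).comp_clm f)

end Basis

/-- The extension to the completion of a bounded operator with bounded inverse. -/
def completionEquiv (S S' : E →L[ℂ] E) (h : ∀ x, S (S' x) = x) (h' : ∀ x, S' (S x) = x) :
    Completion E ≃L[ℂ] Completion E :=
  ContinuousLinearEquiv.equivOfInverse S.completion S'.completion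
    (fun x => by
      induction x using Completion.induction_on with
      | hp => apply isClosed_eq <;> fun_prop
      | ih x => simp [ContinuousLinearMap.completion_apply_coe, h'])
    (fun x => by
      induction x using Completion.induction_on with
      | hp => apply isClosed_eq <;> fun_prop
      | ih x => simp [ContinuousLinearMap.completion_apply_coe, h])

section Sandwich

variable {S S' : E →L[ℂ] E} (h : ∀ x, S (S' x) = x) (h' : ∀ x, S' (S x) = x)

lemma completionEquiv_coe (x : E) :
    completionEquiv S S' h h' (x : Completion E) = ((S x : E) : Completion E) :=
  ContinuousLinearMap.completion_apply_coe _ _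

lemma completionEquiv_symm_coe (x : E) :
    (completionEquiv S S' h h').symm (x : Completion E) = ((S' x : E) : Completion E) :=
  ContinuousLinearMap.completion_apply_coe _ _

/-- The homeomorphism (x, y) ↦ (S x, S⁻¹ y) carries the graph of T' over the core onto that of T,
because S and its inverse both preserve the core. Hence it also matches the closures. -/
lemma closedGraph_eq_sandwich {T T' : E →ₗ[ℂ] E} (hTT' : ∀ x, T' x = S (T (S x))) :
    closedGraph T' = sandwich (completionEquiv S S' h h') (closedGraph T) := by
  set e := completionEquiv S S' h h' with he
  apply le_antisymm
  · intro p hp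
    refine closedGraph_induction (P := fun p => p ∈ sandwich e (closedGraph T))
      (isClosed_sandwich e (isClosed_closedGraph T)) (fun x => ?_) hp
    rw [mem_sandwich, he, completionEquiv_coe, completionEquiv_symm_coe, hTT', h']
    exact coe_mem_closedGraph T _
  · intro p hp
    rw [mem_sandwich] at hp
    have := closedGraph_induction (P := fun q => (e.symm q.1, e q.2) ∈ closedGraph T')
      ((isClosed_closedGraph T').preimage (f := fun q : _ × _ => (e.symm q.1, e q.2))
        (by fun_prop)) (fun x => ?_) hp
    · simpa using this
    · have h1 := coe_mem_closedGraph T' (S' x)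
      rw [hTT', h] at h1
      dsimp only
      rw [he, completionEquiv_coe, completionEquiv_symm_coe]
      exact h1

lemma completionEquiv_symmetric (hS : ∀ x y, ⟪S x, y⟫_ℂ = ⟪x, S y⟫_ℂ) (x y : Completion E) :
    ⟪completionEquiv S S' h h' x, y⟫_ℂ = ⟪x, completionEquiv S S' h h' y⟫_ℂ := by
  induction x, y using Completion.induction_on₂ with
  | hp => apply isClosed_eq <;> fun_prop
  | ih x y => rw [completionEquiv_coe, completionEquiv_coe, Completion.inner_coe,
      Completion.inner_coe, hS]

end Sandwich

/-- The twisted commutator K = T a - a' T extends boundedly to the completion, and (a x, a' y + K x)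
depends continuously on (x, y). It therefore stays in the closed graph, which gives domain
invariance and the bound at once. -/
lemma exists_mem_closedGraph_of_bounded_commutator {T : E →ₗ[ℂ] E} (a a' : E →L[ℂ] E) {C : ℝ}
    (hC : ∀ x, ‖T (a x) - a' (T x)‖ ≤ C * ‖x‖) {p : Completion E × Completion E}
    (hp : p ∈ closedGraph T) :
    ∃ y, (a.completion p.1, y) ∈ closedGraph T ∧ ‖y - a'.completion p.2‖ ≤ C * ‖p.1‖ := by
  let K : E →L[ℂ] E := LinearMap.mkContinuous (T ∘ₗ a.toLinearMap - a'.toLinearMap ∘ₗ T) C hC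
  have hK : ∀ x, K x = T (a x) - a' (T x) := fun x => rfl
  refine ⟨a'.completion p.2 + K.completion p.1, ?_, ?_⟩
  · refine closedGraph_induction
      (P := fun p => (a.completion p.1, a'.completion p.2 + K.completion p.1) ∈ closedGraph T)
      ((isClosed_closedGraph T).preimage
        (f := fun p : _ × _ => (a.completion p.1, a'.completion p.2 + K.completion p.1))
        (by fun_prop)) (fun x => ?_) hp
    dsimp only
    rw [ContinuousLinearMap.completion_apply_coe, ContinuousLinearMap.completion_apply_coe,
      ContinuousLinearMap.completion_apply_coe, ← Completion.coe_add, hK, add_sub_cancel]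
    exact coe_mem_closedGraph T _
  · rw [add_sub_cancel_left]
    generalize p.1 = x
    induction x using Completion.induction_on with
    | hp => exact isClosed_le (by fun_prop) (by fun_prop)
    | ih x =>
      rw [ContinuousLinearMap.completion_apply_coe, Completion.norm_coe, Completion.norm_coe]
      exact hC x

lemma twistedCommutator_closedGraph {T : E →ₗ[ℂ] E}
    (hT : closedGraph T ≤ (closedGraph T).adjoint) (a a' : E →L[ℂ] E)
    (hC : ∃ C : ℝ, ∀ x, ‖T (a x) - a' (T x)‖ ≤ C * ‖x‖) :
    (∀ x ∈ (closedGraph T).toLinearPMap.domain,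
      a.completion x ∈ (closedGraph T).toLinearPMap.domain) ∧
    ∃ C : ℝ, ∀ (x : (closedGraph T).toLinearPMap.domain)
      (hx : a.completion x ∈ (closedGraph T).toLinearPMap.domain),
      ‖(closedGraph T).toLinearPMap ⟨a.completion x, hx⟩ -
        a'.completion ((closedGraph T).toLinearPMap x)‖ ≤ C * ‖(x : Completion E)‖ := by
  obtain ⟨C, hC⟩ := hC
  have hgr := Submodule.toLinearPMap_graph_eq _
    (snd_eq_zero_of_dense hT (dense_map_fst_closedGraph T))
  constructor
  · rintro _ ⟨p, hp, rfl⟩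
    obtain ⟨y, hy, -⟩ := exists_mem_closedGraph_of_bounded_commutator a a' hC hp
    exact ⟨_, hy, rfl⟩
  · refine ⟨C, fun x hx => ?_⟩
    obtain ⟨y, hy, hyC⟩ := exists_mem_closedGraph_of_bounded_commutator a a' hC
      (hgr.le (LinearPMap.mem_graph _ x))
    obtain ⟨z, hz1, hz2⟩ := (LinearPMap.mem_graph_iff _).1 (hgr.ge hy)
    have hz : z = ⟨a.completion x, hx⟩ := Subtype.ext hz1
    rw [← hz, hz2]
    exact hyC

end ClosedGraph

end ModularTriple

/-! ### Derivations, invariance of the trace, and monomials -/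

namespace NCTorus

variable {θ : ℝ}

lemma differentiableAt_α (a : Smooth θ) (s : ℝ × ℝ) :
    DifferentiableAt ℝ (fun s : ℝ × ℝ => α s (a : Ambient θ)) s :=
  (contDiff_α a).differentiable (by simp) s

lemma coe_δ (e : ℝ × ℝ) (a : Smooth θ) : (δ e a : Ambient θ) =
    -Complex.I • fderiv ℝ (fun s : ℝ × ℝ => α s (a : Ambient θ)) 0 e := rfl

lemma δ_mul (e : ℝ × ℝ) (a b : Smooth θ) : δ e (a * b) = δ e a * b + a * δ e b := by
  apply Subtype.ext
  have h := ((differentiableAt_α a 0).hasFDerivAt.mul' (differentiableAt_α b 0).hasFDerivAt).fderiv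
  have h1 : (fun s : ℝ × ℝ => α s ((a * b : Smooth θ) : Ambient θ)) =
      fun s => α s (a : Ambient θ) * α s (b : Ambient θ) := funext fun s => map_mul (α s) _ _
  change (δ e (a * b) : Ambient θ) = (δ e a : Ambient θ) * b + a * (δ e b : Ambient θ)
  rw [coe_δ, coe_δ, coe_δ, h1]
  rw [show (fun s => α s (a : Ambient θ) * α s (b : Ambient θ)) =
    (fun s => α s (a : Ambient θ)) * fun s => α s (b : Ambient θ) from rfl, h]
  simp only [α_zero, add_apply, smul_apply, smul_eq_mul,
    MulOpposite.smul_eq_mul_unop, MulOpposite.unop_op, smul_add, smul_mul_assoc, mul_smul_comm]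
  exact add_comm _ _

/-- The action commutes with the involution; the sign comes from conjugating the factor -i in the
definition of δ. -/
lemma δ_star (e : ℝ × ℝ) (a : Smooth θ) : δ e (star a) = (-1 : ℂ) • star (δ e a) := by
  apply Subtype.ext
  have h := ((starL' ℝ (A := Ambient θ)).toContinuousLinearMap.hasFDerivAt.comp (0 : ℝ × ℝ)
    (differentiableAt_α a 0).hasFDerivAt).fderiv
  have h1 : (fun s : ℝ × ℝ => α s ((star a : Smooth θ) : Ambient θ)) =
      (starL' ℝ (A := Ambient θ)).toContinuousLinearMap ∘ fun s => α s (a : Ambient θ) :=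
    funext fun s => map_star (α s) _
  change (δ e (star a) : Ambient θ) = (-1 : ℂ) • star (δ e a : Ambient θ)
  rw [coe_δ, coe_δ, h1, h, star_smul]
  simp

/-- An eigenvector of the action is an eigenvector of its generators. -/
lemma δ_eq_smul {a : Smooth θ} {p : ℝ × ℝ}
    (ha : ∀ s : ℝ × ℝ, α s (a : Ambient θ) =
      (Circle.exp (s.1 * p.1 + s.2 * p.2) : ℂ) • (a : Ambient θ)) (e : ℝ × ℝ) :
    δ e a = ((e.1 * p.1 + e.2 * p.2 : ℝ) : ℂ) • a := by
  apply Subtype.ext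
  -- Restricted to the line t ↦ t e, the orbit of an eigenvector is a scalar exponential, whose
  -- derivative at 0 is known.
  have h1 : HasDerivAt (fun t : ℝ => α (t • e) (a : Ambient θ))
      (fderiv ℝ (fun s : ℝ × ℝ => α s (a : Ambient θ)) 0 e) 0 := by
    have h2 := (differentiableAt_α a ((0 : ℝ) • e)).hasFDerivAt.comp_hasDerivAt (0 : ℝ)
      ((hasDerivAt_id (0 : ℝ)).smul_const e)
    simp only [zero_smul, one_smul] at h2
    exact h2
  have h3 : HasDerivAt (fun t : ℝ => α (t • e) (a : Ambient θ))
      ((((e.1 * p.1 + e.2 * p.2 : ℝ) : ℂ) * Complex.I) • (a : Ambient θ)) 0 := by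
    have h4 : (fun t : ℝ => α (t • e) (a : Ambient θ)) = fun t : ℝ =>
        Complex.exp (t * (((e.1 * p.1 + e.2 * p.2 : ℝ) : ℂ) * Complex.I)) • (a : Ambient θ) := by
      funext t
      rw [ha, Circle.coe_exp]
      congr 2
      simp only [Prod.smul_fst, Prod.smul_snd, smul_eq_mul]
      push_cast
      ring
    rw [h4]
    have h5 := ((Complex.ofRealCLM.hasDerivAt (x := 0)).mul_const
      (((e.1 * p.1 + e.2 * p.2 : ℝ) : ℂ) * Complex.I)).cexp.smul_const (a : Ambient θ)
    simpa using h5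
  change (δ e a : Ambient θ) = ((e.1 * p.1 + e.2 * p.2 : ℝ) : ℂ) • (a : Ambient θ)
  rw [coe_δ, h1.unique h3, smul_smul]
  congr 1
  linear_combination (-((e.1 * p.1 + e.2 * p.2 : ℝ) : ℂ)) * Complex.I_mul_I

/-- The trace is invariant under the action. -/
lemma φ_α (s : ℝ × ℝ) {a : Ambient θ} (ha : a ∈ A θ) : φ (α s a) = φ a := by
  -- The diagonal unitary multiplying e_{m,n} by e^{i(s₁m + s₂n)} implements α_s in the regular
  -- representation and fixes the vacuum vector, so the vector state is invariant.
  let W : L2 ≃ₗᵢ[ℂ] L2 := wshift (fun i => Circle.exp (s.1 * i.1 + s.2 * i.2)) (Equiv.refl _)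
  have hvac : W vacuum = vacuum := by
    refine lp.ext (funext fun i => ?_)
    by_cases hi : i = (0, 0)
    · subst hi; simp [W, wshift_apply, vacuum]
    · simp [W, wshift_apply, vacuum, hi]
  have hU : (W : L2 →L[ℂ] L2) * (reg θ).u = (Circle.exp s.1 : ℂ) • ((reg θ).u * W) := by
    refine ContinuousLinearMap.ext fun x => lp.ext (funext fun i => ?_)
    change wshift _ _ (wshift _ _ x) i = (Circle.exp s.1 : ℂ) * wshift _ _ (wshift _ _ x) i
    obtain ⟨m, n⟩ := i
    simp only [wshift_apply, left, Equiv.prodCongr_apply, Prod.map, Equiv.subRight_apply,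
      Equiv.refl_apply, Circle.coe_one, one_mul, ← mul_assoc, ← Circle.coe_mul, ← Circle.exp_add]
    congr 3
    push_cast
    ring
  have hV : (W : L2 →L[ℂ] L2) * (reg θ).v = (Circle.exp s.2 : ℂ) • ((reg θ).v * W) := by
    refine ContinuousLinearMap.ext fun x => lp.ext (funext fun i => ?_)
    change wshift _ _ (wshift _ _ x) i = (Circle.exp s.2 : ℂ) * wshift _ _ (wshift _ _ x) i
    obtain ⟨m, n⟩ := i
    simp only [wshift_apply, down, Equiv.prodCongr_apply, Prod.map, Equiv.subRight_apply,
      Equiv.refl_apply]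
    have : Circle.exp (s.1 * m + s.2 * n) =
        Circle.exp s.2 * Circle.exp (s.1 * m + s.2 * (n - 1 : ℤ)) := by
      rw [← Circle.exp_add]
      congr 1
      push_cast
      ring
    rw [this, Circle.coe_mul]
    ring
  let f : Ambient θ →⋆ₐ[ℂ] (L2 →L[ℂ] L2) :=
    (W.conjStarAlgEquiv : (L2 →L[ℂ] L2) →⋆ₐ[ℂ] (L2 →L[ℂ] L2)).comp (evalReg θ)
  have hf : ∀ b x, f b x = W (evalReg θ b (W.symm x)) := fun b x => rfl
  let g : Ambient θ →⋆ₐ[ℂ] (L2 →L[ℂ] L2) := (evalReg θ).comp (α s)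
  -- Conjugation by W and the rotated representation agree on U and V, hence on all of A_θ by
  -- continuity.
  have key : A θ ≤ StarAlgHom.equalizer f g := by
    apply StarSubalgebra.topologicalClosure_minimal
    · refine StarAlgHom.adjoin_le_equalizer _ _ ?_
      rintro x (rfl | rfl)
      · refine ContinuousLinearMap.ext fun x => ?_
        have := congrArg (fun L : L2 →L[ℂ] L2 => L (W.symm x)) hU
        exact this.trans (congrArg (fun y => (Circle.exp s.1 : ℂ) • (reg θ).u y)
          (W.apply_symm_apply x))
      · refine ContinuousLinearMap.ext fun x => ?_
        have := congrArg (fun L : L2 →L[ℂ] L2 => L (W.symm x)) hV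
        exact this.trans (congrArg (fun y => (Circle.exp s.2 : ℂ) • (reg θ).v y)
          (W.apply_symm_apply x))
    · refine isClosed_eq ?_ ((continuous_evalReg θ).comp (αCLM θ s).continuous)
      have h2 : Continuous fun L : L2 →L[ℂ] L2 =>
          (W : L2 →L[ℂ] L2) ∘L L ∘L (W.symm : L2 →L[ℂ] L2) := by fun_prop
      exact h2.comp (continuous_evalReg θ)
  have hvac' : W.symm vacuum = vacuum := by rw [LinearIsometryEquiv.symm_apply_eq, hvac]
  have h1 : evalReg θ (α s a) vacuum = W (evalReg θ a vacuum) := by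
    have := congrArg (fun L : L2 →L[ℂ] L2 => L vacuum) (key ha : f a = g a)
    change f a vacuum = g a vacuum at this
    rw [hf, hvac'] at this
    exact this.symm
  rw [φ_apply, φ_apply, h1, ← W.inner_map_map vacuum (evalReg θ a vacuum), hvac]

/-- The function s ↦ φ(α_s(a)) is constant, so its derivative at 0 vanishes. -/
lemma tr_δ (e : ℝ × ℝ) (a : Smooth θ) : tr (δ e a) = 0 := by
  have h1 : HasFDerivAt (fun s : ℝ × ℝ => φ (α s (a : Ambient θ)))
      ((({ φ (θ := θ) with cont := continuous_φ } : Ambient θ →L[ℂ] ℂ).restrictScalars ℝ) ∘L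
        fderiv ℝ (fun s : ℝ × ℝ => α s (a : Ambient θ)) 0) 0 :=
    (({ φ (θ := θ) with cont := continuous_φ } : Ambient θ →L[ℂ] ℂ).restrictScalars
      ℝ).hasFDerivAt.comp (0 : ℝ × ℝ) (differentiableAt_α a 0).hasFDerivAt
  simp only [φ_α _ a.2.1] at h1
  have h2 := congrArg (fun L => L e) (h1.unique (hasFDerivAt_const _ _))
  change φ (δ e a : Ambient θ) = 0
  rw [coe_δ, map_smul]
  change φ (fderiv ℝ (fun s : ℝ × ℝ => α s (a : Ambient θ)) 0 e) = 0 at h2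
  rw [h2, smul_zero]

/-- Integration by parts: the trace of δ(a* b) is zero, and the sign in `δ_star` makes δ symmetric
rather than skew. -/
lemma tr_star_δ_mul (e : ℝ × ℝ) (a b : Smooth θ) :
    tr (star (δ e a) * b) = tr (star a * δ e b) := by
  have h := tr_δ e (star a * b)
  rw [δ_mul, δ_star, map_add, smul_mul_assoc, map_smul, smul_eq_mul] at h
  linear_combination -h

lemma mem_smooth_of_α_eq {a : Ambient θ} (ha : a ∈ A θ) {p : ℝ × ℝ}
    (h : ∀ s : ℝ × ℝ, α s a = (Circle.exp (s.1 * p.1 + s.2 * p.2) : ℂ) • a) : a ∈ Smooth θ := by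
  refine ⟨ha, ?_⟩
  simp only [h, Circle.coe_exp]
  have h1 : ContDiff ℝ ∞ fun s : ℝ × ℝ => ((s.1 * p.1 + s.2 * p.2 : ℝ) : ℂ) :=
    Complex.ofRealCLM.contDiff.comp
      ((contDiff_fst.mul contDiff_const).add (contDiff_snd.mul contDiff_const))
  exact ((h1.mul contDiff_const).cexp).smul contDiff_const

/-- For every `p` there is a smooth element, namely `U^m V^n` for `p = (m, n)`, with Fourier
coefficients concentrated at `p`. -/
lemma exists_monomial (θ : ℝ) (p : ℤ × ℤ) : ∃ a : Smooth θ, vec a = lp.single 2 p 1 ∧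
    ∀ s : ℝ × ℝ, α s (a : Ambient θ) =
      (Circle.exp (s.1 * (p.1 : ℝ) + s.2 * (p.2 : ℝ)) : ℂ) • (a : Ambient θ) := by
  have hsub := StarSubalgebra.le_topologicalClosure (StarAlgebra.adjoin ℂ {genU θ, genV θ})
  have hU : genU θ ∈ A θ := hsub (StarAlgebra.subset_adjoin ℂ _ (by simp))
  have hV : genV θ ∈ A θ := hsub (StarAlgebra.subset_adjoin ℂ _ (by simp))
  -- Left multiplication by an element of degree r moves a monomial of degree q to degree r + q. It
  -- is applied below to U, V and their adjoints.
  have step : ∀ (g : Ambient θ) (r q : ℤ × ℤ), g ∈ A θ →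
      (∀ s : ℝ × ℝ, α s g = (Circle.exp (s.1 * (r.1 : ℝ) + s.2 * (r.2 : ℝ)) : ℂ) • g) →
      evalReg θ g (lp.single 2 q 1) = lp.single 2 (r + q) 1 →
      (∃ a : Smooth θ, vec a = lp.single 2 q 1 ∧ ∀ s : ℝ × ℝ, α s (a : Ambient θ) =
        (Circle.exp (s.1 * (q.1 : ℝ) + s.2 * (q.2 : ℝ)) : ℂ) • (a : Ambient θ)) →
      ∃ a : Smooth θ, vec a = lp.single 2 (r + q) 1 ∧ ∀ s : ℝ × ℝ, α s (a : Ambient θ) =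
        (Circle.exp (s.1 * ((r + q).1 : ℝ) + s.2 * ((r + q).2 : ℝ)) : ℂ) • (a : Ambient θ) := by
    rintro g r q hg hgα hgv ⟨a, hav, haα⟩
    refine ⟨⟨g, mem_smooth_of_α_eq hg (p := ((r.1 : ℝ), (r.2 : ℝ))) hgα⟩ * a, ?_, fun s => ?_⟩
    · change evalReg θ (g * (a : Ambient θ)) vacuum = _
      rw [map_mul, ← hgv, ← hav]
      rfl
    · change α s (g * (a : Ambient θ)) = _ • (g * (a : Ambient θ))
      rw [map_mul, hgα, haα, smul_mul_smul_comm, ← Circle.coe_mul, ← Circle.exp_add]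
      congr 3
      push_cast [Prod.fst_add, Prod.snd_add]
      ring
  have hαstar : ∀ (g : Ambient θ) (r : ℤ × ℤ),
      (∀ s : ℝ × ℝ, α s g = (Circle.exp (s.1 * (r.1 : ℝ) + s.2 * (r.2 : ℝ)) : ℂ) • g) →
      ∀ s : ℝ × ℝ, α s (star g) =
        (Circle.exp (s.1 * ((-r).1 : ℝ) + s.2 * ((-r).2 : ℝ)) : ℂ) • star g := fun g r hg s => by
    rw [map_star, hg, star_smul]
    congr 1
    rw [RCLike.star_def, ← Circle.coe_inv_eq_conj, ← Circle.exp_neg]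
    congr 2
    push_cast [Prod.fst_neg, Prod.snd_neg]
    ring
  have hUα : ∀ s : ℝ × ℝ, α s (genU θ) =
      (Circle.exp (s.1 * (((1, 0) : ℤ × ℤ).1 : ℝ) + s.2 * (((1, 0) : ℤ × ℤ).2 : ℝ)) : ℂ) •
        genU θ := fun s => by rw [α_genU]; simp
  have hVα : ∀ s : ℝ × ℝ, α s (genV θ) =
      (Circle.exp (s.1 * (((0, 1) : ℤ × ℤ).1 : ℝ) + s.2 * (((0, 1) : ℤ × ℤ).2 : ℝ)) : ℂ) •
        genV θ := fun s => by rw [α_genV]; simp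
  have hUs : ∀ q : ℤ × ℤ, regU (lp.single 2 q 1) = lp.single 2 ((1, 0) + q) 1 := fun q => by
    refine lp.ext (funext fun i => ?_)
    have hiff : left i = q ↔ i = (1, 0) + q := by
      rw [← Equiv.eq_symm_apply]
      simp [left, Prod.ext_iff, add_comm]
    by_cases hi : i = (1, 0) + q
    · simp only [regU, wshift_apply, hiff.2 hi]
      simp [hi]
    · simp [regU, wshift_apply, hi, mt hiff.1 hi]
  -- V acts with weight e^{2πiθm}, which is trivial only in the column m = 0 in general. The powers
  -- of V are therefore built first, and U, which acts without a phase, is then multiplied from the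
  -- left.
  have hVs : ∀ n : ℤ, regV θ (lp.single 2 (0, n) 1) = lp.single 2 ((0, 1) + (0, n)) 1 := fun n => by
    refine lp.ext (funext fun i => ?_)
    have hiff : down i = (0, n) ↔ i = (0, 1) + (0, n) := by
      rw [← Equiv.eq_symm_apply]
      simp [down, Prod.ext_iff, add_comm]
    by_cases hi : i = (0, 1) + (0, n)
    · have h0 : i.1 = 0 := by simp [hi]
      simp only [regV, wshift_apply, hiff.2 hi, h0]
      simp [hi]
    · have hi' : ¬i = (0, 1 + n) := by simpa using hi
      simp [regV, wshift_apply, hi', mt hiff.1 hi]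
  have hsymm : ∀ (g : Ambient θ) (T : L2 ≃ₗᵢ[ℂ] L2) (r q : ℤ × ℤ), evalReg θ g = T →
      T (lp.single 2 (-r + q) 1) = lp.single 2 (r + (-r + q)) 1 →
      evalReg θ (star g) (lp.single 2 q 1) = lp.single 2 (-r + q) 1 := fun g T r q hg h => by
    rw [map_star, hg, ContinuousLinearMap.star_eq_adjoint, LinearIsometryEquiv.adjoint_eq_symm]
    refine (LinearIsometryEquiv.symm_apply_eq T).2 ?_
    rw [h, add_neg_cancel_left]
  have hcol : ∀ n : ℤ, ∃ a : Smooth θ, vec a = lp.single 2 (0, n) 1 ∧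
      ∀ s : ℝ × ℝ, α s (a : Ambient θ) =
        (Circle.exp (s.1 * (((0, n) : ℤ × ℤ).1 : ℝ) + s.2 * (((0, n) : ℤ × ℤ).2 : ℝ)) : ℂ) •
          (a : Ambient θ) := fun n => by
    induction n using Int.induction_on with
    | zero => exact ⟨1, rfl, fun s => by simp⟩
    | succ n ih =>
      have := step _ (0, 1) (0, (n : ℤ)) hV hVα (hVs n) ih
      rwa [Prod.mk_add_mk, zero_add, add_comm (1 : ℤ)] at this
    | pred n ih =>
      have := step _ (-(0, 1)) (0, (-n : ℤ)) (star_mem hV) (hαstar _ _ hVα)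
        (hsymm _ (regV θ) _ _ rfl (hVs _)) ih
      rwa [Prod.neg_mk, Prod.mk_add_mk, neg_zero, zero_add, add_comm (-1 : ℤ), ← sub_eq_add_neg]
        at this
  obtain ⟨m, n⟩ := p
  induction m using Int.induction_on with
  | zero => exact hcol n
  | succ m ih =>
    have := step _ (1, 0) ((m : ℤ), n) hU hUα (hUs _) ih
    rwa [Prod.mk_add_mk, zero_add, add_comm (1 : ℤ)] at this
  | pred m ih =>
    have := step _ (-(1, 0)) ((-m : ℤ), n) (star_mem hU) (hαstar _ _ hUα)
      (hsymm _ regU _ _ rfl (hUs _)) ih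
    rwa [Prod.neg_mk, Prod.mk_add_mk, neg_zero, zero_add, add_comm (-1 : ℤ), ← sub_eq_add_neg]
      at this

end NCTorus

/-! ### The unperturbed operator on smooth forms -/

namespace NCTorus

open Filter Topology

section Forms

variable {θ : ℝ} {τ : UpperHalfPlane}

lemma normSq_coe_eq (τ : UpperHalfPlane) : Complex.normSq τ = τ.re ^ 2 + τ.im ^ 2 := by
  rw [Complex.normSq_apply]; simp [sq]

lemma inner_vec_δ (e : ℝ × ℝ) (a b : Smooth θ) :
    ⟪vec (δ e a), vec b⟫_ℂ = ⟪vec a, vec (δ e b)⟫_ℂ := by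
  rw [← tr_star_mul, ← tr_star_mul, tr_star_δ_mul]

lemma d_apply_zero (x : Fin 2 → Smooth θ) : d θ τ x 0 = Complex.I • δ₁ (x 0) +
    ((Complex.I * Complex.normSq τ) • δ₂ (x 1) + (Complex.I * τ.re) • δ₁ (x 1)) := by
  simp [d, ofBlocks, Fin.sum_univ_two]

lemma d_apply_one (x : Fin 2 → Smooth θ) : d θ τ x 1 = Complex.I • δ₂ (x 0) +
    ((-(Complex.I * τ.re)) • δ₂ (x 1) + (-Complex.I) • δ₁ (x 1)) := by
  simp [d, ofBlocks, Fin.sum_univ_two, sub_eq_add_neg]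

lemma dStar_apply_zero (x : Fin 2 → Smooth θ) : dStar θ τ x 0 =
    ((-Complex.I) • δ₁ (x 0) + (-(Complex.I * τ.re)) • δ₂ (x 0)) +
    ((-(Complex.I * τ.re)) • δ₁ (x 1) + (-(Complex.I * Complex.normSq τ)) • δ₂ (x 1)) := by
  simp [dStar, ofBlocks, Fin.sum_univ_two, sub_eq_add_neg]

lemma dStar_apply_one (x : Fin 2 → Smooth θ) : dStar θ τ x 1 =
    (-Complex.I) • δ₂ (x 0) + Complex.I • δ₁ (x 1) := by
  simp [dStar, ofBlocks, Fin.sum_univ_two]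

lemma smul_fst (c : ℂ) (x : PreForms θ τ) (i : Fin 2) : (c • x).1 i = c • x.1 i := rfl

lemma smul_snd (c : ℂ) (x : PreForms θ τ) (i : Fin 2) : (c • x).2 i = c • x.2 i := rfl

lemma add_fst (x y : PreForms θ τ) (i : Fin 2) : (x + y).1 i = x.1 i + y.1 i := rfl

lemma add_snd (x y : PreForms θ τ) (i : Fin 2) : (x + y).2 i = x.2 i + y.2 i := rfl

lemma sub_fst (x y : PreForms θ τ) (i : Fin 2) : (x - y).1 i = x.1 i - y.1 i := rfl

lemma sub_snd (x y : PreForms θ τ) (i : Fin 2) : (x - y).2 i = x.2 i - y.2 i := rfl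

/-- The unperturbed operator `d + d*` on smooth forms. -/
def diracCore (θ : ℝ) (τ : UpperHalfPlane) : PreForms θ τ →ₗ[ℂ] PreForms θ τ where
  toFun x := (dStar θ τ x.2, d θ τ x.1)
  map_add' x y := Prod.ext (map_add (dStar θ τ) x.2 y.2) (map_add (d θ τ) x.1 y.1)
  map_smul' c x := Prod.ext (map_smul (dStar θ τ) c x.2) (map_smul (d θ τ) c x.1)

lemma diracCore_fst (x : PreForms θ τ) : (diracCore θ τ x).1 = dStar θ τ x.2 := rfl

lemma diracCore_snd (x : PreForms θ τ) : (diracCore θ τ x).2 = d θ τ x.1 := rfl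

/-- Completing the square in g_τ⁻¹: with a₁ + Re τ a₂ and a₂ as variables the metric on one forms is
diagonal. -/
lemma inner_eq (x y : PreForms θ τ) : ⟪x, y⟫_ℂ =
    (1 / τ.im : ℝ) * ⟪vec (x.1 0), vec (y.1 0)⟫_ℂ + (τ.im : ℝ) * ⟪vec (x.1 1), vec (y.1 1)⟫_ℂ +
    (1 / τ.im : ℝ) * ⟪vec (x.2 0 + (τ.re : ℂ) • x.2 1), vec (y.2 0 + (τ.re : ℂ) • y.2 1)⟫_ℂ +
    (τ.im : ℝ) * ⟪vec (x.2 1), vec (y.2 1)⟫_ℂ := by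
  have ht : (τ.im : ℂ) ≠ 0 := Complex.ofReal_ne_zero.2 τ.im_pos.ne'
  rw [inner_def]
  simp only [preInner, tr_star_mul, gInv, Fin.sum_univ_two, Matrix.of_apply, Matrix.cons_val',
    Matrix.cons_val_zero, Matrix.cons_val_one, Matrix.cons_val_fin_one, normSq_coe_eq, map_add,
    map_smul, inner_add_left, inner_add_right, inner_smul_left, inner_smul_right,
    Complex.conj_ofReal]
  push_cast
  field_simp
  ring

/-- Each δ_j is symmetric for the trace pairing. What remains is that d and d* have mutually adjoint
coefficients for the metric, where |τ|² = (Re τ)² + (Im τ)² enters. -/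
lemma inner_diracCore (x y : PreForms θ τ) :
    ⟪diracCore θ τ x, y⟫_ℂ = ⟪x, diracCore θ τ y⟫_ℂ := by
  have ht : (τ.im : ℂ) ≠ 0 := Complex.ofReal_ne_zero.2 τ.im_pos.ne'
  rw [inner_eq, inner_eq]
  simp only [diracCore_fst, diracCore_snd, d_apply_zero, d_apply_one, dStar_apply_zero,
    dStar_apply_one, map_add, map_smul, inner_add_left, inner_add_right, inner_smul_left,
    inner_smul_right, inner_vec_δ, normSq_coe_eq, map_neg, map_mul, Complex.conj_I,
    Complex.conj_ofReal]
  push_cast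
  field_simp
  ring

/-- On joint eigenvectors δ₁ and δ₂ act as commuting scalars. The off-diagonal terms of d d* and d*
d cancel and leave the quadratic form of g_τ⁻¹ at (m, n). -/
lemma diracCore_diracCore {x : PreForms θ τ} {m n : ℂ}
    (h1 : ∀ i, δ₁ (x.1 i) = m • x.1 i) (h2 : ∀ i, δ₂ (x.1 i) = n • x.1 i)
    (h3 : ∀ i, δ₁ (x.2 i) = m • x.2 i) (h4 : ∀ i, δ₂ (x.2 i) = n • x.2 i) :
    diracCore θ τ (diracCore θ τ x) =
      (m ^ 2 + 2 * τ.re * m * n + Complex.normSq τ * n ^ 2) • x := by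
  refine PreForms.ext (Fin.forall_fin_two.2 ⟨?_, ?_⟩) (Fin.forall_fin_two.2 ⟨?_, ?_⟩) <;>
  · simp only [smul_fst, smul_snd]
    simp only [diracCore_fst, diracCore_snd, d_apply_zero, d_apply_one, dStar_apply_zero,
      dStar_apply_one, map_add, map_smul, h1, h2, h3, h4]
    match_scalars <;> ring_nf
    all_goals
      simp only [Complex.I_sq]
      ring

end Forms

end NCTorus

/-! ### Hilbert basis of forms and the spectrum of the squared operator -/

namespace NCTorus

open Filter Topology

section Basis

variable {θ : ℝ} {τ : UpperHalfPlane}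

/-- The element `U^m V^n` for `p = (m, n)`. -/
def monomial (θ : ℝ) (p : ℤ × ℤ) : Smooth θ := (exists_monomial θ p).choose

lemma vec_monomial (p : ℤ × ℤ) : vec (monomial θ p) = lp.single 2 p 1 :=
  (exists_monomial θ p).choose_spec.1

lemma δ_monomial (e : ℝ × ℝ) (p : ℤ × ℤ) :
    δ e (monomial θ p) = ((e.1 * p.1 + e.2 * p.2 : ℝ) : ℂ) • monomial θ p :=
  δ_eq_smul (p := ((p.1 : ℝ), (p.2 : ℝ))) (exists_monomial θ p).choose_spec.2 e

/-- The entries of a form in an orthonormal frame. -/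
def coord (x : PreForms θ τ) : Fin 4 → Smooth θ :=
  ![((√τ.im)⁻¹ : ℂ) • x.1 0, (√τ.im : ℂ) • x.1 1,
    ((√τ.im)⁻¹ : ℂ) • (x.2 0 + (τ.re : ℂ) • x.2 1), (√τ.im : ℂ) • x.2 1]

/-- The form with given entries in an orthonormal frame. -/
def ofCoord (θ : ℝ) (τ : UpperHalfPlane) : (Fin 4 → Smooth θ) →ₗ[ℂ] PreForms θ τ where
  toFun a := (![(√τ.im : ℂ) • a 0, ((√τ.im)⁻¹ : ℂ) • a 1],
    ![(√τ.im : ℂ) • a 2 + (-(τ.re * (√τ.im)⁻¹) : ℂ) • a 3, ((√τ.im)⁻¹ : ℂ) • a 3])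
  map_add' a b := by
    refine PreForms.ext (Fin.forall_fin_two.2 ⟨smul_add _ (a 0) (b 0), smul_add _ (a 1) (b 1)⟩)
      (Fin.forall_fin_two.2 ⟨?_, smul_add _ (a 3) (b 3)⟩)
    change (√τ.im : ℂ) • (a 2 + b 2) + (-(τ.re * (√τ.im)⁻¹) : ℂ) • (a 3 + b 3) =
      ((√τ.im : ℂ) • a 2 + (-(τ.re * (√τ.im)⁻¹) : ℂ) • a 3) +
        ((√τ.im : ℂ) • b 2 + (-(τ.re * (√τ.im)⁻¹) : ℂ) • b 3)
    module
  map_smul' c a := by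
    refine PreForms.ext (Fin.forall_fin_two.2 ⟨smul_comm _ c (a 0), smul_comm _ c (a 1)⟩)
      (Fin.forall_fin_two.2 ⟨?_, smul_comm _ c (a 3)⟩)
    change (√τ.im : ℂ) • c • a 2 + (-(τ.re * (√τ.im)⁻¹) : ℂ) • c • a 3 =
      c • ((√τ.im : ℂ) • a 2 + (-(τ.re * (√τ.im)⁻¹) : ℂ) • a 3)
    module

lemma ofCoord_fst_zero (a : Fin 4 → Smooth θ) :
    (ofCoord θ τ a).1 0 = (√τ.im : ℂ) • a 0 := rfl

lemma ofCoord_fst_one (a : Fin 4 → Smooth θ) :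
    (ofCoord θ τ a).1 1 = ((√τ.im)⁻¹ : ℂ) • a 1 := rfl

lemma ofCoord_snd_zero (a : Fin 4 → Smooth θ) : (ofCoord θ τ a).2 0 =
    (√τ.im : ℂ) • a 2 + (-(τ.re * (√τ.im)⁻¹) : ℂ) • a 3 := rfl

lemma ofCoord_snd_one (a : Fin 4 → Smooth θ) :
    (ofCoord θ τ a).2 1 = ((√τ.im)⁻¹ : ℂ) • a 3 := rfl

lemma sqrt_im_ne_zero (τ : UpperHalfPlane) : (√τ.im : ℂ) ≠ 0 :=
  Complex.ofReal_ne_zero.2 (Real.sqrt_pos.2 τ.im_pos).ne'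

lemma sqrt_im_sq (τ : UpperHalfPlane) : (√τ.im : ℂ) ^ 2 = τ.im := by
  rw [← Complex.ofReal_pow, Real.sq_sqrt τ.im_pos.le]

lemma coord_ofCoord (a : Fin 4 → Smooth θ) : coord (ofCoord θ τ a) = a := by
  have h := sqrt_im_ne_zero τ
  funext j
  fin_cases j <;>
  · simp only [coord, ofCoord_fst_zero, ofCoord_fst_one, ofCoord_snd_zero, ofCoord_snd_one,
      Fin.zero_eta, Fin.mk_one, Fin.reduceFinMk, Matrix.cons_val]
    match_scalars <;> field_simp
    try ring

/-- The frame turns the space of forms into four orthogonal copies of the space of Fourier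
coefficients, which is what makes the monomials an orthonormal system. -/
lemma inner_eq_sum_coord (x y : PreForms θ τ) :
    ⟪x, y⟫_ℂ = ∑ j, ⟪vec (coord x j), vec (coord y j)⟫_ℂ := by
  have h := sqrt_im_ne_zero τ
  rw [inner_eq, Fin.sum_univ_four]
  simp only [coord, Matrix.cons_val, map_smul, inner_smul_left, inner_smul_right, map_inv₀,
    Complex.conj_ofReal]
  push_cast
  rw [← sqrt_im_sq]
  field_simp

/-- The forms whose entries in an orthonormal frame are a monomial and zeros. -/
def basisForm (θ : ℝ) (τ : UpperHalfPlane) (i : Fin 4 × (ℤ × ℤ)) : PreForms θ τ :=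
  ofCoord θ τ (Pi.single i.1 (monomial θ i.2))

lemma inner_basisForm (i : Fin 4 × (ℤ × ℤ)) (x : PreForms θ τ) :
    ⟪basisForm θ τ i, x⟫_ℂ = vec (coord x i.1) i.2 := by
  rw [inner_eq_sum_coord, basisForm, coord_ofCoord, Finset.sum_eq_single i.1]
  · rw [Pi.single_eq_same, vec_monomial, lp.inner_single_left]
    simp
  · intro j _ hj
    rw [Pi.single_eq_of_ne hj, map_zero, inner_zero_left]
  · simp

lemma orthonormal_basisForm :
    Orthonormal ℂ fun i => (basisForm θ τ i : Forms θ τ) := by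
  classical
  rw [orthonormal_iff_ite]
  intro i j
  rw [UniformSpace.Completion.inner_coe, inner_basisForm, basisForm, coord_ofCoord]
  by_cases h1 : i.1 = j.1
  · rw [h1, Pi.single_eq_same, vec_monomial]
    by_cases h2 : i.2 = j.2
    · rw [if_pos (Prod.ext h1 h2), h2]
      simp
    · rw [if_neg fun h => h2 (congrArg _ h)]
      simp [h2]
  · rw [if_neg fun h => h1 (congrArg _ h), Pi.single_eq_of_ne h1, map_zero]
    rfl

lemma mem_closure_span_basisForm (x : PreForms θ τ) :
    (x : Forms θ τ) ∈
      (Submodule.span ℂ (Set.range fun i => (basisForm θ τ i : Forms θ τ))).topologicalClosure := by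
  -- Partial Fourier sums of the frame entries. They are finite combinations of basis forms, and
  -- their convergence in ℓ²(ℤ²) is convergence in the norm of forms, which sees only Fourier
  -- coefficients.
  let a : Finset (ℤ × ℤ) → Fin 4 → Smooth θ := fun F j =>
    ∑ p ∈ F, vec (coord x j) p • monomial θ p
  have hvec : ∀ j, Tendsto (fun F => vec (a F j)) atTop (𝓝 (vec (coord x j))) := fun j => by
    refine (lp.hasSum_single (p := 2) (by simp) (vec (coord x j))).congr fun F => ?_
    simp only [a, map_sum, map_smul, vec_monomial]
    refine Finset.sum_congr rfl fun p _ => ?_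
    rw [← lp.single_smul]
    simp
  have hnorm : Tendsto (fun F => ‖ofCoord θ τ (a F) - x‖ ^ 2) atTop (𝓝 0) := by
    have h1 : ∀ F, ‖ofCoord θ τ (a F) - x‖ ^ 2 =
        ∑ j, ‖vec (a F j) - vec (coord x j)‖ ^ 2 := fun F => by
      have h2 : ∀ j, coord (ofCoord θ τ (a F) - x) j = a F j - coord x j := fun j => by
        conv_rhs => rw [← coord_ofCoord (τ := τ) (a F)]
        fin_cases j <;> simp [coord, sub_fst, sub_snd] <;> module
      rw [norm_sq_eq_re_inner (𝕜 := ℂ), inner_eq_sum_coord, map_sum]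
      refine Finset.sum_congr rfl fun j _ => ?_
      rw [h2, map_sub, norm_sq_eq_re_inner (𝕜 := ℂ)]
    simp only [h1]
    rw [show (0 : ℝ) = ∑ j : Fin 4, ‖vec (coord x j) - vec (coord x j)‖ ^ 2 by simp]
    exact tendsto_finsetSum _ fun j _ => (((hvec j).sub_const _).norm.pow 2)
  have hlim : Tendsto (fun F => ((ofCoord θ τ (a F) : PreForms θ τ) : Forms θ τ)) atTop
      (𝓝 (x : Forms θ τ)) := by
    rw [tendsto_iff_norm_sub_tendsto_zero]
    have := hnorm.sqrt
    simpa only [Real.sqrt_sq (norm_nonneg _), Real.sqrt_zero, ← UniformSpace.Completion.coe_sub,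
      UniformSpace.Completion.norm_coe] using this
  refine mem_closure_of_tendsto hlim (Eventually.of_forall fun F => ?_)
  have h3 : ofCoord θ τ (a F) = ∑ j, ∑ p ∈ F, vec (coord x j) p • basisForm θ τ (j, p) := by
    rw [← Finset.univ_sum_single (a F), map_sum]
    refine Finset.sum_congr rfl fun j _ => ?_
    rw [← LinearMap.coe_single (R := ℂ), ← LinearMap.comp_apply]
    simp only [a, map_sum, map_smul]
    rfl
  rw [h3]
  change (UniformSpace.Completion.toComplₗᵢ (𝕜 := ℂ) (E := PreForms θ τ)) _ ∈ _
  simp only [map_sum, map_smul]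
  exact Submodule.sum_mem _ fun j _ => Submodule.sum_mem _ fun p _ =>
    Submodule.smul_mem _ _ (Submodule.subset_span ⟨(j, p), rfl⟩)

/-- The Hilbert basis of the space of forms given by the monomials in an orthonormal frame. -/
def formsBasis (θ : ℝ) (τ : UpperHalfPlane) : HilbertBasis (Fin 4 × (ℤ × ℤ)) ℂ (Forms θ τ) :=
  HilbertBasis.mk orthonormal_basisForm fun x _ => by
    refine UniformSpace.Completion.denseRange_coe.induction_on x ?_ mem_closure_span_basisForm
    exact Submodule.isClosed_topologicalClosure _

lemma formsBasis_apply (i : Fin 4 × (ℤ × ℤ)) : formsBasis θ τ i = basisForm θ τ i := by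
  rw [formsBasis, HilbertBasis.coe_mk]

/-- The quadratic form `|m + τ n|²`. -/
def latticeNormSq (τ : UpperHalfPlane) (p : ℤ × ℤ) : ℝ :=
  (p.1 + τ.re * p.2) ^ 2 + (τ.im * p.2) ^ 2

lemma latticeNormSq_nonneg (τ : UpperHalfPlane) (p : ℤ × ℤ) : 0 ≤ latticeNormSq τ p := by
  unfold latticeNormSq; positivity

/-- Because Im τ > 0, a bound |m + τn|² < B first bounds n by √B / Im τ and then m, so only finitely
many lattice points satisfy it. The factor `Fin 4` only multiplies their number by four. -/
lemma tendsto_latticeNormSq (τ : UpperHalfPlane) :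
    Tendsto (fun i : Fin 4 × (ℤ × ℤ) => latticeNormSq τ i.2) cofinite atTop := by
  refine tendsto_atTop.2 fun B => ?_
  have ht := τ.im_pos
  rw [eventually_cofinite]
  -- The three terms sum the bounds for |m| and |n|, so that one N serves for both.
  obtain ⟨N, hN⟩ := exists_nat_ge (√B + |τ.re| * (√B / τ.im) + √B / τ.im)
  refine ((Set.finite_univ (α := Fin 4)).prod
    (Set.finite_Icc ((-N, -N) : ℤ × ℤ) (N, N))).subset ?_
  rintro ⟨j, m, n⟩ h
  have h' : (m + τ.re * n) ^ 2 + (τ.im * n) ^ 2 < B := not_le.1 h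
  have h1 : |(m + τ.re * n : ℝ)| ≤ √B := Real.abs_le_sqrt (by nlinarith [sq_nonneg (τ.im * n)])
  have h2 : |(n : ℝ)| ≤ √B / τ.im := by
    rw [le_div_iff₀ ht, mul_comm]
    nth_rw 1 [← abs_of_pos ht]
    rw [← abs_mul]
    exact Real.abs_le_sqrt (by nlinarith [sq_nonneg (m + τ.re * n)])
  have h3 : |(m : ℝ)| ≤ √B + |τ.re| * (√B / τ.im) := by
    calc |(m : ℝ)| = |(m + τ.re * n) - τ.re * n| := by ring_nf
      _ ≤ |(m + τ.re * n : ℝ)| + |τ.re * n| := abs_sub _ _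
      _ ≤ _ := by rw [abs_mul]; gcongr
  have h4 : 0 ≤ √B / τ.im := by positivity
  have h5 : 0 ≤ √B + |τ.re| * (√B / τ.im) := by positivity
  have h6 : |m| ≤ (N : ℤ) := by exact_mod_cast (show |(m : ℝ)| ≤ N by linarith)
  have h7 : |n| ≤ (N : ℤ) := by exact_mod_cast (show |(n : ℝ)| ≤ N by linarith)
  exact ⟨Set.mem_univ _, ⟨(abs_le.1 h6).1, (abs_le.1 h7).1⟩, ⟨(abs_le.1 h6).2, (abs_le.1 h7).2⟩⟩

lemma diracCore_diracCore_basisForm (i : Fin 4 × (ℤ × ℤ)) :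
    diracCore θ τ (diracCore θ τ (basisForm θ τ i)) =
      (latticeNormSq τ i.2 : ℂ) • basisForm θ τ i := by
  obtain ⟨j, p⟩ := i
  have hδ : ∀ e k, δ e ((Pi.single j (monomial θ p) : Fin 4 → Smooth θ) k) =
      ((e.1 * p.1 + e.2 * p.2 : ℝ) : ℂ) • (Pi.single j (monomial θ p) : Fin 4 → Smooth θ) k := by
    intro e k
    by_cases hk : k = j
    · subst hk
      rw [Pi.single_eq_same, δ_monomial]
    · rw [Pi.single_eq_of_ne hk, map_zero, smul_zero]
  rw [diracCore_diracCore (m := (p.1 : ℂ)) (n := (p.2 : ℂ))]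
  · congr 1
    rw [normSq_coe_eq, latticeNormSq]
    push_cast
    ring
  all_goals
    refine Fin.forall_fin_two.2 ⟨?_, ?_⟩ <;>
    · simp only [basisForm, ofCoord_fst_zero, ofCoord_fst_one, ofCoord_snd_zero, ofCoord_snd_one,
        map_add, map_smul, hδ]
      push_cast
      module

end Basis

end NCTorus

/-! ### Entrywise bounds and bounded commutators -/

namespace NCTorus

open ModularTriple

section Triples

variable {θ : ℝ} {τ : UpperHalfPlane}

/-- An entry depending boundedly on a form. -/
def IsBdd (f : PreForms θ τ → Smooth θ) : Prop := ∃ C : ℝ, ∀ x, ‖vec (f x)‖ ≤ C * ‖x‖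

lemma IsBdd.add {f g : PreForms θ τ → Smooth θ} (hf : IsBdd f) (hg : IsBdd g) :
    IsBdd fun x => f x + g x := by
  obtain ⟨C, hC⟩ := hf
  obtain ⟨C', hC'⟩ := hg
  refine ⟨C + C', fun x => ?_⟩
  rw [map_add, add_mul]
  exact (norm_add_le _ _).trans (add_le_add (hC x) (hC' x))

lemma IsBdd.smul (c : ℂ) {f : PreForms θ τ → Smooth θ} (hf : IsBdd f) :
    IsBdd fun x => c • f x := by
  obtain ⟨C, hC⟩ := hf
  refine ⟨‖c‖ * C, fun x => ?_⟩
  rw [map_smul, norm_smul, mul_assoc]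
  exact mul_le_mul_of_nonneg_left (hC x) (norm_nonneg _)

lemma IsBdd.comp {f : PreForms θ τ → Smooth θ} (hf : IsBdd f) {N : Smooth θ → Smooth θ}
    (hN : ∃ C : ℝ, ∀ x, ‖vec (N x)‖ ≤ C * ‖vec x‖) : IsBdd fun x => N (f x) := by
  obtain ⟨C, hC⟩ := hf
  obtain ⟨C', hC'⟩ := hN
  refine ⟨|C'| * C, fun x => (hC' _).trans ?_⟩
  rw [mul_assoc]
  exact (mul_le_mul_of_nonneg_right (le_abs_self _) (norm_nonneg _)).trans
    (mul_le_mul_of_nonneg_left (hC x) (abs_nonneg _))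

lemma IsBdd.mul_right {f : PreForms θ τ → Smooth θ} (hf : IsBdd f) (a : Smooth θ) :
    IsBdd fun x => f x * a :=
  hf.comp (N := fun y => y * a) ⟨‖(a : Ambient θ)‖, fun x => norm_vec_mul_le' a x⟩

lemma IsBdd.mul_left {f : PreForms θ τ → Smooth θ} (hf : IsBdd f) (a : Smooth θ) :
    IsBdd fun x => a * f x :=
  hf.comp (N := fun y => a * y) ⟨‖(a : Ambient θ)‖, fun x => norm_vec_mul_le a x⟩

lemma isBdd_of_sq_le {f : PreForms θ τ → Smooth θ} {C : ℝ}
    (h : ∀ x, ‖vec (f x)‖ ^ 2 ≤ C * ‖x‖ ^ 2) : IsBdd f := by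
  refine ⟨√|C|, fun x => ?_⟩
  refine abs_le_of_sq_le_sq' ?_ (by positivity) |>.2
  rw [mul_pow, Real.sq_sqrt (abs_nonneg _)]
  exact (h x).trans (mul_le_mul_of_nonneg_right (le_abs_self _) (sq_nonneg _))

lemma isBdd_fst (i : Fin 2) : IsBdd fun x : PreForms θ τ => x.1 i := by
  have ht := τ.im_pos
  fin_cases i
  · refine isBdd_of_sq_le (C := τ.im) fun x => ?_
    rw [norm_sq_def, mul_add, mul_add, ← mul_assoc, mul_one_div_cancel ht.ne', one_mul, add_assoc]
    exact le_add_of_nonneg_right (by positivity)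
  · refine isBdd_of_sq_le (C := 1 / τ.im) fun x => ?_
    rw [norm_sq_def, add_right_comm, mul_add (1 / τ.im) _ (τ.im * _), ← mul_assoc _ τ.im,
      one_div_mul_cancel ht.ne', one_mul]
    exact le_add_of_nonneg_left (by positivity)

lemma isBdd_snd (i : Fin 2) : IsBdd fun x : PreForms θ τ => x.2 i := by
  have ht := τ.im_pos
  have h1 : IsBdd fun x : PreForms θ τ => x.2 1 := by
    refine isBdd_of_sq_le (C := 1 / τ.im) fun x => ?_
    have : ‖vec (x.2 1)‖ ^ 2 = 1 / τ.im * (1 / τ.im * (τ.im ^ 2 * ‖vec (x.2 1)‖ ^ 2)) := by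
      field_simp
    rw [norm_sq_def]
    refine this.trans_le (mul_le_mul_of_nonneg_left ?_ (by positivity))
    have h2 : 0 ≤ 1 / τ.im * ‖vec (x.1 0)‖ ^ 2 + τ.im * ‖vec (x.1 1)‖ ^ 2 +
      1 / τ.im * ‖vec (x.2 0 + (τ.re : ℂ) • x.2 1)‖ ^ 2 := by positivity
    linarith
  have h0 : IsBdd fun x : PreForms θ τ => x.2 0 + (τ.re : ℂ) • x.2 1 := by
    refine isBdd_of_sq_le (C := τ.im) fun x => ?_
    have : ‖vec (x.2 0 + (τ.re : ℂ) • x.2 1)‖ ^ 2 =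
        τ.im * (1 / τ.im * ‖vec (x.2 0 + (τ.re : ℂ) • x.2 1)‖ ^ 2) := by
      field_simp
    rw [norm_sq_def]
    refine this.trans_le (mul_le_mul_of_nonneg_left ?_ (by positivity))
    have h2 : 0 ≤ 1 / τ.im * ‖vec (x.1 0)‖ ^ 2 + τ.im * ‖vec (x.1 1)‖ ^ 2 +
      1 / τ.im * (τ.im ^ 2 * ‖vec (x.2 1)‖ ^ 2) := by positivity
    rw [mul_add]
    linarith
  fin_cases i
  -- The norm controls a₁ + Re τ a₂ and a₂, not a₁ directly; a₁ is recovered by subtraction.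
  · have := h0.add (h1.smul (-τ.re : ℂ))
    refine (funext fun x => ?_ :
      (fun x : PreForms θ τ => x.2 0 + (τ.re : ℂ) • x.2 1 + (-τ.re : ℂ) • x.2 1) =
        fun x => x.2 0) ▸ this
    module
  · exact h1

/-- Together with `isBdd_fst` and `isBdd_snd` this reduces boundedness of an operator on forms to
boundedness of its four entries. -/
lemma exists_bound_of_isBdd {L : PreForms θ τ → PreForms θ τ}
    (h1 : ∀ i, IsBdd fun x => (L x).1 i) (h2 : ∀ i, IsBdd fun x => (L x).2 i) :
    ∃ C : ℝ, ∀ x, ‖L x‖ ≤ C * ‖x‖ := by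
  have ht := τ.im_pos
  obtain ⟨C₁, hC₁⟩ := h1 0
  obtain ⟨C₂, hC₂⟩ := h1 1
  obtain ⟨C₃, hC₃⟩ := (h2 0).add ((h2 1).smul (τ.re : ℂ))
  obtain ⟨C₄, hC₄⟩ := h2 1
  have hsq : ∀ {a C b : ℝ}, 0 ≤ a → a ≤ C * b → a ^ 2 ≤ C ^ 2 * b ^ 2 := fun ha h => by
    rw [← mul_pow]; exact pow_le_pow_left₀ ha h 2
  refine ⟨√(1 / τ.im * C₁ ^ 2 + τ.im * C₂ ^ 2 + 1 / τ.im * (C₃ ^ 2 + τ.im ^ 2 * C₄ ^ 2)),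
    fun x => ?_⟩
  refine abs_le_of_sq_le_sq' ?_ (by positivity) |>.2
  rw [mul_pow, Real.sq_sqrt (by positivity), norm_sq_def]
  calc _ ≤ 1 / τ.im * (C₁ ^ 2 * ‖x‖ ^ 2) + τ.im * (C₂ ^ 2 * ‖x‖ ^ 2) +
        1 / τ.im * (C₃ ^ 2 * ‖x‖ ^ 2 + τ.im ^ 2 * (C₄ ^ 2 * ‖x‖ ^ 2)) := by
        gcongr
        · exact hsq (norm_nonneg _) (hC₁ x)
        · exact hsq (norm_nonneg _) (hC₂ x)
        · exact hsq (norm_nonneg _) (hC₃ x)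
        · exact hsq (norm_nonneg _) (hC₄ x)
    _ = _ := by ring

/-- The operators on `A_θ^∞` with bounded commutators with left and right multiplications. -/
def firstOrder (θ : ℝ) : Submodule ℂ (Module.End ℂ (Smooth θ)) where
  carrier := {N | ∀ a, (∃ C : ℝ, ∀ x, ‖vec (N (x * a) - N x * a)‖ ≤ C * ‖vec x‖) ∧
    ∃ C : ℝ, ∀ x, ‖vec (N (a * x) - a * N x)‖ ≤ C * ‖vec x‖}
  zero_mem' a := ⟨⟨0, fun x => by simp⟩, ⟨0, fun x => by simp⟩⟩
  add_mem' {N N'} h h' a := by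
    obtain ⟨⟨C, hC⟩, ⟨B, hB⟩⟩ := h a
    obtain ⟨⟨C', hC'⟩, ⟨B', hB'⟩⟩ := h' a
    refine ⟨⟨C + C', fun x => ?_⟩, ⟨B + B', fun x => ?_⟩⟩
    · rw [LinearMap.add_apply, LinearMap.add_apply, add_mul, add_sub_add_comm, map_add, add_mul]
      exact (norm_add_le _ _).trans (add_le_add (hC x) (hC' x))
    · rw [LinearMap.add_apply, LinearMap.add_apply, mul_add, add_sub_add_comm, map_add, add_mul]
      exact (norm_add_le _ _).trans (add_le_add (hB x) (hB' x))
  smul_mem' c N h a := by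
    obtain ⟨⟨C, hC⟩, ⟨B, hB⟩⟩ := h a
    refine ⟨⟨‖c‖ * C, fun x => ?_⟩, ⟨‖c‖ * B, fun x => ?_⟩⟩
    · rw [LinearMap.smul_apply, LinearMap.smul_apply, smul_mul_assoc, ← smul_sub, map_smul,
        norm_smul, mul_assoc]
      exact mul_le_mul_of_nonneg_left (hC x) (norm_nonneg _)
    · rw [LinearMap.smul_apply, LinearMap.smul_apply, mul_smul_comm, ← smul_sub, map_smul,
        norm_smul, mul_assoc]
      exact mul_le_mul_of_nonneg_left (hB x) (norm_nonneg _)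

/-- By the Leibniz rule the commutator with multiplication by a is multiplication by δ a, bounded by
its C*-norm. On the right this bound rests on the trace property. -/
lemma δ_mem_firstOrder (e : ℝ × ℝ) : (δ e : Module.End ℂ (Smooth θ)) ∈ firstOrder θ := by
  refine fun a => ⟨⟨‖(δ e a : Ambient θ)‖, fun x => ?_⟩,
    ⟨‖(δ e a : Ambient θ)‖, fun x => ?_⟩⟩
  · rw [δ_mul, add_sub_cancel_left]
    exact norm_vec_mul_le' _ _
  · rw [δ_mul, add_sub_cancel_right]
    exact norm_vec_mul_le _ _

lemma ofBlocks_apply (M : Matrix (Fin 2) (Fin 2) (Module.End ℂ (Smooth θ)))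
    (y : Fin 2 → Smooth θ) (i : Fin 2) :
    ofBlocks M y i = M i 0 (y 0) + M i 1 (y 1) := by
  simp [ofBlocks, Fin.sum_univ_two]

section Blocks

variable {M : Matrix (Fin 2) (Fin 2) (Module.End ℂ (Smooth θ))}

lemma isBdd_ofBlocks_mul_right (hM : ∀ i j, M i j ∈ firstOrder θ) (a : Smooth θ)
    {f : PreForms θ τ → Fin 2 → Smooth θ} (hf : ∀ j, IsBdd fun x => f x j) (i : Fin 2) :
    IsBdd fun x => ofBlocks M (fun j => f x j * a) i - ofBlocks M (f x) i * a := by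
  have h := ((hf 0).comp (hM i 0 a).1).add ((hf 1).comp (hM i 1 a).1)
  simpa only [ofBlocks_apply, add_mul, add_sub_add_comm] using h

lemma isBdd_ofBlocks_mul_left (hM : ∀ i j, M i j ∈ firstOrder θ) (a : Smooth θ)
    {f : PreForms θ τ → Fin 2 → Smooth θ} (hf : ∀ j, IsBdd fun x => f x j) (i : Fin 2) :
    IsBdd fun x => ofBlocks M (fun j => a * f x j) i - a * ofBlocks M (f x) i := by
  have h := ((hf 0).comp (hM i 0 a).2).add ((hf 1).comp (hM i 1 a).2)
  simpa only [ofBlocks_apply, mul_add, add_sub_add_comm] using h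

end Blocks

end Triples

end NCTorus

/-! ### The perturbed operators and their modular spectral triples -/

namespace NCTorus

open ModularTriple

section Triples

variable {θ : ℝ} {τ : UpperHalfPlane}

/-- The commutator estimates need only that the entries are combinations of derivations, so the
coefficients are hidden behind an existential. -/
lemma d_blocks_mem_firstOrder (τ : UpperHalfPlane) :
    ∃ M : Matrix (Fin 2) (Fin 2) (Module.End ℂ (Smooth θ)),
      d θ τ = ofBlocks M ∧ ∀ i j, M i j ∈ firstOrder θ := by
  refine ⟨_, rfl, fun i j => ?_⟩
  have h := δ_mem_firstOrder (θ := θ)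
  fin_cases i <;> fin_cases j
  · exact Submodule.smul_mem _ _ (h _)
  · exact Submodule.add_mem _ (Submodule.smul_mem _ _ (h _)) (Submodule.smul_mem _ _ (h _))
  · exact Submodule.smul_mem _ _ (h _)
  · exact Submodule.sub_mem _ (Submodule.smul_mem _ _ (h _)) (Submodule.smul_mem _ _ (h _))

lemma dStar_blocks_mem_firstOrder (τ : UpperHalfPlane) :
    ∃ M : Matrix (Fin 2) (Fin 2) (Module.End ℂ (Smooth θ)),
      dStar θ τ = ofBlocks M ∧ ∀ i j, M i j ∈ firstOrder θ := by
  refine ⟨_, rfl, fun i j => ?_⟩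
  have h := δ_mem_firstOrder (θ := θ)
  fin_cases i <;> fin_cases j
  · exact Submodule.sub_mem _ (Submodule.smul_mem _ _ (h _)) (Submodule.smul_mem _ _ (h _))
  · exact Submodule.sub_mem _ (Submodule.smul_mem _ _ (h _)) (Submodule.smul_mem _ _ (h _))
  · exact Submodule.smul_mem _ _ (h _)
  · exact Submodule.smul_mem _ _ (h _)

/-- Right multiplication by `a` on even forms. -/
def evenRight (θ : ℝ) (τ : UpperHalfPlane) (a : Smooth θ) : PreForms θ τ →L[ℂ] PreForms θ τ :=
  LinearMap.mkContinuousOfExistsBound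
    (LinearMap.prodMap (entrywise (LinearMap.mulRight ℂ a)) LinearMap.id :
      PreForms θ τ →ₗ[ℂ] PreForms θ τ)
    (exists_bound_of_isBdd (fun i => (isBdd_fst i).mul_right a) isBdd_snd)

/-- Left multiplication by `a` on odd forms. -/
def oddLeft (θ : ℝ) (τ : UpperHalfPlane) (a : Smooth θ) : PreForms θ τ →L[ℂ] PreForms θ τ :=
  LinearMap.mkContinuousOfExistsBound
    (LinearMap.prodMap LinearMap.id (entrywise (LinearMap.mulLeft ℂ a)) :
      PreForms θ τ →ₗ[ℂ] PreForms θ τ)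
    (exists_bound_of_isBdd isBdd_fst (fun i => (isBdd_snd i).mul_left a))

lemma evenRight_fst (a : Smooth θ) (x : PreForms θ τ) (i : Fin 2) :
    (evenRight θ τ a x).1 i = x.1 i * a := rfl

lemma evenRight_snd (a : Smooth θ) (x : PreForms θ τ) : (evenRight θ τ a x).2 = x.2 := rfl

lemma oddLeft_fst (a : Smooth θ) (x : PreForms θ τ) : (oddLeft θ τ a x).1 = x.1 := rfl

lemma oddLeft_snd (a : Smooth θ) (x : PreForms θ τ) (i : Fin 2) :
    (oddLeft θ τ a x).2 i = a * x.2 i := rfl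

lemma evenRight_evenRight {a b : Smooth θ} (h : b * a = 1) (x : PreForms θ τ) :
    evenRight θ τ a (evenRight θ τ b x) = x :=
  PreForms.ext (fun i => by rw [evenRight_fst, evenRight_fst, mul_assoc, h, mul_one])
    (fun i => rfl)

lemma oddLeft_oddLeft {a b : Smooth θ} (h : a * b = 1) (x : PreForms θ τ) :
    oddLeft θ τ a (oddLeft θ τ b x) = x :=
  PreForms.ext (fun i => rfl)
    (fun i => by rw [oddLeft_snd, oddLeft_snd, ← mul_assoc, h, one_mul])

/-- Cyclicity of the trace is essential here; left multiplication needs only the involution. -/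
lemma inner_vec_mul_right {a : Smooth θ} (ha : star a = a) (x y : Smooth θ) :
    ⟪vec (x * a), vec y⟫_ℂ = ⟪vec x, vec (y * a)⟫_ℂ := by
  rw [← tr_star_mul, ← tr_star_mul, star_mul, ha, mul_assoc, tr_mul_comm, mul_assoc]

lemma inner_vec_mul_left {a : Smooth θ} (ha : star a = a) (x y : Smooth θ) :
    ⟪vec (a * x), vec y⟫_ℂ = ⟪vec x, vec (a * y)⟫_ℂ := by
  rw [← tr_star_mul, ← tr_star_mul, star_mul, ha, mul_assoc]

lemma inner_evenRight {a : Smooth θ} (ha : star a = a) (x y : PreForms θ τ) :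
    ⟪evenRight θ τ a x, y⟫_ℂ = ⟪x, evenRight θ τ a y⟫_ℂ := by
  simp only [inner_eq, evenRight_fst, evenRight_snd, inner_vec_mul_right ha]

lemma inner_oddLeft {a : Smooth θ} (ha : star a = a) (x y : PreForms θ τ) :
    ⟪oddLeft θ τ a x, y⟫_ℂ = ⟪x, oddLeft θ τ a y⟫_ℂ := by
  simp only [inner_eq, oddLeft_fst, oddLeft_snd, ← mul_smul_comm, ← mul_add, inner_vec_mul_left ha]

lemma star_weyl {h : Smooth θ} (hh : IsSelfAdjoint h) :
    star (weyl h : Smooth θ) = weyl h := by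
  apply Subtype.ext
  let _ : NormedAlgebra ℚ (Ambient θ) := NormedAlgebra.restrictScalars ℚ ℂ _
  change star (NormedSpace.exp (((1 / 2 : ℂ) • h : Smooth θ) : Ambient θ)) =
    NormedSpace.exp (((1 / 2 : ℂ) • h : Smooth θ) : Ambient θ)
  rw [NormedSpace.star_exp]
  congr 1
  have h1 : star ((1 / 2 : ℂ) • h) = (1 / 2 : ℂ) • h := by
    rw [star_smul, hh.star_eq]
    congr 1
    simp
  exact congrArg Subtype.val h1

lemma star_weyl_inv {h : Smooth θ} (hh : IsSelfAdjoint h) :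
    star ((weyl h)⁻¹ : (Smooth θ)ˣ).val = ((weyl h)⁻¹ : (Smooth θ)ˣ).val := by
  have h1 : star (weyl h) = weyl h := Units.ext (star_weyl hh)
  rw [← Units.coe_star, star_inv, h1]

lemma adjoint_closedGraph_diracCore (θ : ℝ) (τ : UpperHalfPlane) :
    (closedGraph (diracCore θ τ)).adjoint = closedGraph (diracCore θ τ) :=
  adjoint_closedGraph_eq inner_diracCore formsBasis_apply diracCore_diracCore_basisForm
    fun i => latticeNormSq_nonneg τ i.2

lemma isCompactOperator_fst_diracCore (θ : ℝ) (τ : UpperHalfPlane) :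
    IsCompactOperator fun p : closedGraph (diracCore θ τ) => (p : Forms θ τ × Forms θ τ).1 :=
  isCompactOperator_fst_closedGraph inner_diracCore formsBasis_apply diracCore_diracCore_basisForm
    (fun i => latticeNormSq_nonneg τ i.2) (tendsto_latticeNormSq τ)

/-- The operator `S (d + d*) S` for a bounded invertible symmetric `S` is self-adjoint with compact
resolvent. -/
lemma closedGraph_of_sandwich {S S' : PreForms θ τ →L[ℂ] PreForms θ τ}
    (h : ∀ x, S (S' x) = x) (h' : ∀ x, S' (S x) = x) (hS : ∀ x y, ⟪S x, y⟫_ℂ = ⟪x, S y⟫_ℂ)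
    {T : PreForms θ τ →ₗ[ℂ] PreForms θ τ} (hT : ∀ x, T x = S (diracCore θ τ (S x))) :
    (closedGraph T).adjoint = closedGraph T ∧ HasCompactResolvent (closedGraph T).toLinearPMap := by
  have hG := closedGraph_eq_sandwich h h' hT
  have h1 : (closedGraph T).adjoint = closedGraph T := by
    rw [hG]
    exact adjoint_sandwich _ (completionEquiv_symmetric h h' hS) (adjoint_closedGraph_diracCore θ τ)
  refine ⟨h1, hasCompactResolvent_toLinearPMap (isClosed_closedGraph T) h1
    (dense_map_fst_closedGraph T) ?_⟩
  rw [hG]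
  exact isCompactOperator_fst_sandwich _ (isCompactOperator_fst_diracCore θ τ)

/-- S acts by R_k on even forms only: it precedes d and follows d*, which produces d ∘ R_k and R_k ∘
d*. -/
lemma closedGraph_DTildeCore {h : Smooth θ} (hh : IsSelfAdjoint h) :
    (closedGraph (DTildeCore (τ := τ) h)).adjoint = closedGraph (DTildeCore h) ∧
      HasCompactResolvent (closedGraph (DTildeCore (τ := τ) h)).toLinearPMap :=
  closedGraph_of_sandwich (S := evenRight θ τ (weyl h))
    (S' := evenRight θ τ ((weyl h)⁻¹ : (Smooth θ)ˣ).val)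
    (evenRight_evenRight (Units.inv_mul _)) (evenRight_evenRight (Units.mul_inv _))
    (inner_evenRight (star_weyl hh)) fun _ => rfl

/-- Here S acts by k on odd forms only: it follows d and precedes d*, which produces k d and d* k.
-/
lemma closedGraph_DBarCore {h : Smooth θ} (hh : IsSelfAdjoint h) :
    (closedGraph (DBarCore (τ := τ) h)).adjoint = closedGraph (DBarCore h) ∧
      HasCompactResolvent (closedGraph (DBarCore (τ := τ) h)).toLinearPMap :=
  closedGraph_of_sandwich (S := oddLeft θ τ (weyl h))
    (S' := oddLeft θ τ ((weyl h)⁻¹ : (Smooth θ)ˣ).val)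
    (oddLeft_oddLeft (Units.mul_inv _)) (oddLeft_oddLeft (Units.inv_mul _))
    (inner_oddLeft (star_weyl hh)) fun _ => rfl

lemma bounded_twistedCommutator_DTildeCore (h a : Smooth θ) :
    ∃ C : ℝ, ∀ x : PreForms θ τ, ‖DTildeCore h (rightMul a x) -
      rightMul (((weyl h)⁻¹ : (Smooth θ)ˣ).val * a * (weyl h : Smooth θ)) (DTildeCore h x)‖ ≤
        C * ‖x‖ := by
  obtain ⟨M, hM, hM'⟩ := d_blocks_mem_firstOrder (θ := θ) τ
  obtain ⟨M₁, hM₁, hM₁'⟩ := dStar_blocks_mem_firstOrder (θ := θ) τ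
  set k := weyl h
  refine exists_bound_of_isBdd (fun i => ?_) (fun i => ?_)
  -- On odd forms, d*(x a) k - d*(x) k (k⁻¹ a k) = (d*(x a) - d*(x) a) k.
  · have h1 := (isBdd_ofBlocks_mul_right hM₁' a (isBdd_snd (τ := τ)) i).mul_right k.val
    rw [← hM₁] at h1
    refine (funext fun x => ?_ : _ = fun x : PreForms θ τ => (DTildeCore h (rightMul a x) -
      rightMul (k⁻¹.val * a * k.val) (DTildeCore h x)).1 i) ▸ h1
    rw [sub_fst, rightMul_fst, sub_mul]
    refine congrArg₂ _ rfl ?_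
    change _ = dStar θ τ x.2 i * k.val * (k⁻¹.val * a * k.val)
    rw [mul_assoc (k⁻¹.val), ← mul_assoc, mul_assoc (dStar θ τ x.2 i) k.val, Units.mul_inv, mul_one,
      ← mul_assoc]
  -- On even forms x a k = (x k)(k⁻¹ a k), so the twisted commutator is that of d with right
  -- multiplication by k⁻¹ a k, evaluated at x k.
  · have h1 := isBdd_ofBlocks_mul_right hM' (k⁻¹.val * a * k.val)
      (fun j => (isBdd_fst (τ := τ) j).mul_right k.val) i
    rw [← hM] at h1
    refine (funext fun x => ?_ : _ = fun x : PreForms θ τ => (DTildeCore h (rightMul a x) -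
      rightMul (k⁻¹.val * a * k.val) (DTildeCore h x)).2 i) ▸ h1
    rw [sub_snd, rightMul_snd]
    refine congrArg₂ _ ?_ rfl
    refine congrFun (congrArg (d θ τ) (funext fun j => ?_)) i
    change _ = x.1 j * a * k.val
    rw [mul_assoc (k⁻¹.val), ← mul_assoc, mul_assoc (x.1 j) k.val, Units.mul_inv, mul_one,
      ← mul_assoc]

lemma bounded_twistedCommutator_DBarCore (h a : Smooth θ) :
    ∃ C : ℝ, ∀ x : PreForms θ τ, ‖DBarCore h (leftMul a x) -
      leftMul ((weyl h : Smooth θ) * a * ((weyl h)⁻¹ : (Smooth θ)ˣ).val) (DBarCore h x)‖ ≤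
        C * ‖x‖ := by
  obtain ⟨M, hM, hM'⟩ := d_blocks_mem_firstOrder (θ := θ) τ
  obtain ⟨M₁, hM₁, hM₁'⟩ := dStar_blocks_mem_firstOrder (θ := θ) τ
  set k := weyl h
  refine exists_bound_of_isBdd (fun i => ?_) (fun i => ?_)
  -- On odd forms k a x = (k a k⁻¹)(k x), so the twisted commutator is that of d* with left
  -- multiplication by k a k⁻¹, evaluated at k x.
  · have h1 := isBdd_ofBlocks_mul_left hM₁' (k.val * a * k⁻¹.val)
      (fun j => (isBdd_snd (τ := τ) j).mul_left k.val) i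
    rw [← hM₁] at h1
    refine (funext fun x => ?_ : _ = fun x : PreForms θ τ => (DBarCore h (leftMul a x) -
      leftMul (k.val * a * k⁻¹.val) (DBarCore h x)).1 i) ▸ h1
    rw [sub_fst, leftMul_fst]
    refine congrArg₂ _ ?_ rfl
    refine congrFun (congrArg (dStar θ τ) (funext fun j => ?_)) i
    change _ = k.val * (a * x.2 j)
    rw [mul_assoc, ← mul_assoc (k⁻¹.val), Units.inv_mul, one_mul, mul_assoc]
  -- On even forms, k d(a x) - (k a k⁻¹) k d(x) = k (d(a x) - a d(x)).
  · have h1 := (isBdd_ofBlocks_mul_left hM' a (isBdd_fst (τ := τ)) i).mul_left k.val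
    rw [← hM] at h1
    refine (funext fun x => ?_ : _ = fun x : PreForms θ τ => (DBarCore h (leftMul a x) -
      leftMul (k.val * a * k⁻¹.val) (DBarCore h x)).2 i) ▸ h1
    rw [sub_snd, leftMul_snd, mul_sub]
    refine congrArg₂ _ rfl ?_
    change _ = k.val * a * k⁻¹.val * (k.val * d θ τ x.1 i)
    rw [mul_assoc (k.val * a), ← mul_assoc (k⁻¹.val), Units.inv_mul, one_mul, mul_assoc]

lemma isModularSpectralTriple_tildeTriple (τ : UpperHalfPlane) {h : Smooth θ}
    (hh : IsSelfAdjoint h) : (tildeTriple θ τ h).IsModularSpectralTriple where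
  twist_star a := by
    apply MulOpposite.unop_injective
    change ((weyl h)⁻¹ : (Smooth θ)ˣ).val * star a.unop * ((weyl h)⁻¹⁻¹ : (Smooth θ)ˣ).val =
      star (((weyl h)⁻¹⁻¹ : (Smooth θ)ˣ).val * a.unop * ((weyl h)⁻¹ : (Smooth θ)ˣ).val)
    rw [star_mul, star_mul, star_weyl_inv hh, inv_inv, star_weyl hh, mul_assoc]
  isSelfAdjoint :=
    isSelfAdjoint_toLinearPMap (closedGraph_DTildeCore hh).1 (dense_map_fst_closedGraph _)
  compactResolvent := (closedGraph_DTildeCore hh).2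
  rep_mem_domain a := (twistedCommutator_closedGraph (closedGraph_DTildeCore hh).1.ge _ _
    (bounded_twistedCommutator_DTildeCore h a.unop)).1
  bounded_twistedCommutator a := by
    have := (twistedCommutator_closedGraph (closedGraph_DTildeCore (τ := τ) hh).1.ge _ _
      (bounded_twistedCommutator_DTildeCore h a.unop)).2
    exact this

lemma isModularSpectralTriple_barTriple (τ : UpperHalfPlane) {h : Smooth θ}
    (hh : IsSelfAdjoint h) : (barTriple θ τ h).IsModularSpectralTriple where
  twist_star a := by
    change (weyl h : Smooth θ) * star a * ((weyl h)⁻¹ : (Smooth θ)ˣ).val =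
      star (((weyl h)⁻¹ : (Smooth θ)ˣ).val * a * (weyl h : Smooth θ))
    rw [star_mul, star_mul, star_weyl_inv hh, star_weyl hh, mul_assoc]
  isSelfAdjoint :=
    isSelfAdjoint_toLinearPMap (closedGraph_DBarCore hh).1 (dense_map_fst_closedGraph _)
  compactResolvent := (closedGraph_DBarCore hh).2
  rep_mem_domain a := (twistedCommutator_closedGraph (closedGraph_DBarCore hh).1.ge _ _
    (bounded_twistedCommutator_DBarCore h a)).1
  bounded_twistedCommutator a := (twistedCommutator_closedGraph (closedGraph_DBarCore hh).1.ge _ _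
    (bounded_twistedCommutator_DBarCore h a)).2

end Triples

end NCTorus

/-! ### The transpose of a self-adjoint operator -/

namespace ModularTriple

variable {H : Type*} [NormedAddCommGroup H] [InnerProductSpace ℂ H] [CompleteSpace H]

/-- Under the Riesz map the condition m(x) = ℓ(D x) becomes, after conjugation, the defining
condition of the adjoint relation, and the adjoint is G itself. -/
lemma mem_graph_transposePMap {G : Submodule ℂ (H × H)} (hG : G.adjoint = G)
    (hd : Dense (G.map (LinearMap.fst ℂ H H) : Set H)) (p : StrongDual ℂ H × StrongDual ℂ H) :
    p ∈ (transposePMap G.toLinearPMap).graph ↔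
      ((InnerProductSpace.toDual ℂ H).symm p.1, (InnerProductSpace.toDual ℂ H).symm p.2) ∈ G := by
  have hgr := Submodule.toLinearPMap_graph_eq _ (snd_eq_zero_of_dense hG.ge hd)
  rw [transposePMap, Submodule.toLinearPMap_graph_eq]
  · conv_rhs => rw [← hG, mem_adjoint_iff_inner_eq]
    change (∀ x : G.toLinearPMap.domain, p.2 x = p.1 (G.toLinearPMap x)) ↔ _
    have key : ∀ q : H × H, p.2 q.1 = p.1 q.2 ↔
        ⟪q.2, (InnerProductSpace.toDual ℂ H).symm p.1⟫_ℂ =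
          ⟪q.1, (InnerProductSpace.toDual ℂ H).symm p.2⟫_ℂ := fun q => by
      rw [← inner_conj_symm, ← inner_conj_symm q.1, InnerProductSpace.toDual_symm_apply,
        InnerProductSpace.toDual_symm_apply, (starRingEnd ℂ).injective.eq_iff, eq_comm]
    constructor
    · intro h q hq
      obtain ⟨x, hx1, hx2⟩ := (LinearPMap.mem_graph_iff _).1 (hgr.ge hq)
      rw [← key, ← hx1, ← hx2]
      exact h x
    · intro h x
      exact (key ((x : H), G.toLinearPMap x)).2 (h _ (hgr.le (LinearPMap.mem_graph _ x)))
  -- The transposed relation is single-valued: for ℓ = 0 the functional m vanishes on the dense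
  -- domain, hence everywhere.
  · intro q hq h0
    refine DFunLike.coe_injective (Continuous.ext_on hd q.2.continuous
      (0 : StrongDual ℂ H).continuous ?_)
    rintro _ ⟨r, hr, rfl⟩
    obtain ⟨x, hx1, hx2⟩ := (LinearPMap.mem_graph_iff _).1 (hgr.ge hr)
    have := hq x
    rw [h0, hx1] at this
    exact this

end ModularTriple

/-! ### The antiunitary intertwiner and the isomorphism with the transpose -/

namespace NCTorus

open ModularTriple

section Transpose

variable {θ : ℝ} {τ : UpperHalfPlane}

/-- The antilinear map composed of the involution and the exchange of even and odd forms that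
identifies the orthonormal frames of the two. -/
def starSwap (x : PreForms θ τ) : PreForms θ τ :=
  (![star (x.2 0 + (τ.re : ℂ) • x.2 1), star (x.2 1)],
    ![(-1 : ℂ) • star (x.1 0) + (τ.re : ℂ) • star (x.1 1), (-1 : ℂ) • star (x.1 1)])

lemma starSwap_fst_zero (x : PreForms θ τ) :
    (starSwap x).1 0 = star (x.2 0 + (τ.re : ℂ) • x.2 1) := rfl

lemma starSwap_fst_one (x : PreForms θ τ) : (starSwap x).1 1 = star (x.2 1) := rfl

lemma starSwap_snd_zero (x : PreForms θ τ) :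
    (starSwap x).2 0 = (-1 : ℂ) • star (x.1 0) + (τ.re : ℂ) • star (x.1 1) := rfl

lemma starSwap_snd_one (x : PreForms θ τ) : (starSwap x).2 1 = (-1 : ℂ) • star (x.1 1) := rfl

lemma starSwap_add (x y : PreForms θ τ) : starSwap (x + y) = starSwap x + starSwap y := by
  refine PreForms.ext (Fin.forall_fin_two.2 ⟨?_, ?_⟩) (Fin.forall_fin_two.2 ⟨?_, ?_⟩) <;>
  · simp only [add_fst, add_snd, starSwap_fst_zero, starSwap_fst_one, starSwap_snd_zero,
      starSwap_snd_one, star_add, star_smul]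
    try module

lemma starSwap_smul (c : ℂ) (x : PreForms θ τ) :
    starSwap (c • x) = (starRingEnd ℂ c) • starSwap x := by
  refine PreForms.ext (Fin.forall_fin_two.2 ⟨?_, ?_⟩) (Fin.forall_fin_two.2 ⟨?_, ?_⟩) <;>
  · simp only [smul_fst, smul_snd, starSwap_fst_zero, starSwap_fst_one, starSwap_snd_zero,
      starSwap_snd_one, star_add, star_smul, RCLike.star_def]
    try module

/-- The square -1 reflects the signs on one of the two halves; it gives surjectivity on smooth
forms. -/
lemma starSwap_starSwap (x : PreForms θ τ) : starSwap (starSwap x) = (-1 : ℂ) • x := by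
  refine PreForms.ext (Fin.forall_fin_two.2 ⟨?_, ?_⟩) (Fin.forall_fin_two.2 ⟨?_, ?_⟩) <;>
  · simp only [smul_fst, smul_snd, starSwap_fst_zero, starSwap_fst_one, starSwap_snd_zero,
      starSwap_snd_one, star_add, star_smul, star_star, RCLike.star_def, map_neg, map_one,
      Complex.conj_ofReal]
    try module

lemma starSwap_surjective : Function.Surjective (starSwap : PreForms θ τ → PreForms θ τ) :=
  fun x => ⟨(-1 : ℂ) • starSwap x, by
    rw [starSwap_smul, starSwap_starSwap, smul_smul]
    simp⟩

/-- In the orthonormal frame the map permutes the four entries up to sign and takes adjoints, and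
the involution is isometric because φ is a trace. -/
lemma norm_starSwap (x : PreForms θ τ) : ‖starSwap x‖ = ‖x‖ := by
  have ht := τ.im_pos
  have h1 : ‖starSwap x‖ ^ 2 = ‖x‖ ^ 2 := by
    have h2 : (starSwap x).2 0 + (τ.re : ℂ) • (starSwap x).2 1 = (-1 : ℂ) • star (x.1 0) := by
      rw [starSwap_snd_zero, starSwap_snd_one]
      module
    rw [norm_sq_def, norm_sq_def, h2, starSwap_snd_one, starSwap_fst_zero, starSwap_fst_one,
      norm_vec_star, norm_vec_star, map_smul, norm_smul, map_smul, norm_smul, norm_vec_star,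
      norm_vec_star, norm_neg, norm_one, one_mul, one_mul]
    field_simp
    ring
  exact (sq_eq_sq₀ (norm_nonneg _) (norm_nonneg _)).1 h1

lemma starSwap_leftMul (a : Smooth θ) (x : PreForms θ τ) :
    starSwap (leftMul a x) = rightMul (star a) (starSwap x) := by
  refine PreForms.ext (Fin.forall_fin_two.2 ⟨?_, ?_⟩) (Fin.forall_fin_two.2 ⟨?_, ?_⟩) <;>
  simp only [rightMul_fst, rightMul_snd, leftMul_fst, leftMul_snd, starSwap_fst_zero,
    starSwap_fst_one, starSwap_snd_zero, starSwap_snd_one, star_add, star_smul, star_mul, add_mul,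
    smul_mul_assoc]

/-- The involution moves k = k* from left to right, and the exchange of parities carries k d to R_k
∘ d* and d* k to d ∘ R_k. The signs from δ(a*) = -(δ a)*, from conjugating i and from `starSwap`
itself cancel. -/
lemma starSwap_DBarCore {h : Smooth θ} (hh : IsSelfAdjoint h) (x : PreForms θ τ) :
    starSwap (DBarCore h x) = DTildeCore h (starSwap x) := by
  have hk := star_weyl hh
  have hb1 : (DBarCore h x).1 = dStar θ τ fun j => (weyl h : Smooth θ) * x.2 j := rfl
  have hb2 : ∀ i, (DBarCore h x).2 i = (weyl h : Smooth θ) * d θ τ x.1 i := fun i => rfl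
  have ht1 : ∀ y : PreForms θ τ, ∀ i, (DTildeCore h y).1 i = dStar θ τ y.2 i * weyl h :=
    fun y i => rfl
  have ht2 : ∀ y : PreForms θ τ, (DTildeCore h y).2 = d θ τ fun j => y.1 j * weyl h :=
    fun y => rfl
  have hstarδ : ∀ e (a : Smooth θ), star (δ e a) = (-1 : ℂ) • δ e (star a) := fun e a => by
    rw [δ_star, smul_smul]; simp
  refine PreForms.ext (Fin.forall_fin_two.2 ⟨?_, ?_⟩) (Fin.forall_fin_two.2 ⟨?_, ?_⟩)
  · rw [ht1, starSwap_fst_zero]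
    simp only [hb2, d_apply_zero, d_apply_one, dStar_apply_zero, starSwap_snd_zero,
      starSwap_snd_one, star_add, star_smul, star_mul, hk, hstarδ, map_add, map_smul, add_mul,
      smul_mul_assoc, RCLike.star_def, map_mul, map_neg, Complex.conj_I, Complex.conj_ofReal]
    module
  · rw [ht1, starSwap_fst_one]
    simp only [hb2, d_apply_one, dStar_apply_one, starSwap_snd_zero,
      starSwap_snd_one, star_add, star_smul, star_mul, hk, hstarδ, map_add, map_smul, add_mul,
      smul_mul_assoc, RCLike.star_def, map_mul, map_neg, Complex.conj_I, Complex.conj_ofReal]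
    module
  · rw [ht2, starSwap_snd_zero]
    simp only [hb1, d_apply_zero, dStar_apply_zero, dStar_apply_one, starSwap_fst_zero,
      starSwap_fst_one, star_add, star_smul, star_mul, hk, hstarδ, map_add, map_smul, add_mul,
      smul_mul_assoc, RCLike.star_def, map_mul, map_neg, Complex.conj_I, Complex.conj_ofReal]
    module
  · rw [ht2, starSwap_snd_one]
    simp only [hb1, d_apply_one, dStar_apply_one, starSwap_fst_zero,
      starSwap_fst_one, star_add, star_smul, star_mul, hk, hstarδ, map_add, map_smul, add_mul,
      smul_mul_assoc, RCLike.star_def, map_neg, Complex.conj_I, Complex.conj_ofReal]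
    module

/-- The map from smooth forms to the dual induced by `starSwap`. -/
def preTransposeMap (θ : ℝ) (τ : UpperHalfPlane) :
    PreForms θ τ →ₗᵢ[ℂ] StrongDual ℂ (Forms θ τ) where
  toFun x := InnerProductSpace.toDual ℂ (Forms θ τ) ((starSwap x : PreForms θ τ) : Forms θ τ)
  map_add' x y := by rw [starSwap_add, UniformSpace.Completion.coe_add, map_add]
  map_smul' c x := by
    rw [starSwap_smul, UniformSpace.Completion.coe_smul, map_smulₛₗ, RingHom.id_apply]
    simp
  norm_map' x := by
    change ‖InnerProductSpace.toDual ℂ (Forms θ τ) ((starSwap x : PreForms θ τ) : Forms θ τ)‖ = _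
    rw [LinearIsometryEquiv.norm_map, UniformSpace.Completion.norm_coe, norm_starSwap]

lemma exists_transposeEquiv (θ : ℝ) (τ : UpperHalfPlane) :
    ∃ W : Forms θ τ ≃ₗᵢ[ℂ] StrongDual ℂ (Forms θ τ), ∀ x : PreForms θ τ,
      W (x : Forms θ τ) =
        InnerProductSpace.toDual ℂ (Forms θ τ) ((starSwap x : PreForms θ τ) : Forms θ τ) := by
  let e : PreForms θ τ →ₗᵢ[ℂ] Forms θ τ := UniformSpace.Completion.toComplₗᵢ
  have hde : DenseRange e := UniformSpace.Completion.denseRange_coe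
  let L : Forms θ τ →L[ℂ] StrongDual ℂ (Forms θ τ) :=
    (preTransposeMap θ τ).toContinuousLinearMap.extend e.toContinuousLinearMap
  have hL : ∀ x : PreForms θ τ, L (x : Forms θ τ) = preTransposeMap θ τ x := fun x =>
    ContinuousLinearMap.extend_eq _ hde e.isometry.isUniformInducing x
  have hcont : Continuous fun x => ‖L x‖ :=
    (continuous_norm (E := StrongDual ℂ (Forms θ τ))).comp L.continuous
  have hnorm : ∀ x, ‖L x‖ = ‖x‖ := fun x => by
    induction x using UniformSpace.Completion.induction_on with
    | hp => exact isClosed_eq hcont continuous_norm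
    | ih x => rw [hL, LinearIsometry.norm_map, UniformSpace.Completion.norm_coe]
  let Li : Forms θ τ →ₗᵢ[ℂ] StrongDual ℂ (Forms θ τ) := ⟨L.toLinearMap, hnorm⟩
  -- An isometry of a complete space has closed range, and this range contains the Riesz images of
  -- all smooth forms, since `starSwap` is onto them.
  have hsurj : Function.Surjective Li := by
    rw [← Set.range_eq_univ, ← Li.isometry.isClosedEmbedding.isClosed_range.closure_eq]
    refine Dense.closure_eq ?_
    have hd : DenseRange fun x : PreForms θ τ =>
        InnerProductSpace.toDual ℂ (Forms θ τ) (x : Forms θ τ) :=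
      (InnerProductSpace.toDual ℂ (Forms θ τ)).surjective.denseRange.comp
        UniformSpace.Completion.denseRange_coe (LinearIsometryEquiv.continuous _)
    refine hd.mono ?_
    rintro _ ⟨x, rfl⟩
    obtain ⟨y, rfl⟩ := starSwap_surjective x
    exact ⟨(y : Forms θ τ), hL y⟩
  exact ⟨LinearIsometryEquiv.ofSurjective Li hsurj, hL⟩

/-- The unitary W extends the Riesz map after `starSwap`. It is linear because both factors are
antilinear. -/
lemma isIsomorphic_transpose_tildeTriple (τ : UpperHalfPlane) {h : Smooth θ}
    (hh : IsSelfAdjoint h) : (barTriple θ τ h).IsIsomorphic (tildeTriple θ τ h).transpose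
      (opOpStar (Smooth θ)) := by
  obtain ⟨W, hW⟩ := exists_transposeEquiv θ τ
  refine ⟨fun a => ?_, W, fun a x => ?_, fun x y => ?_⟩
  · apply MulOpposite.unop_injective
    apply MulOpposite.unop_injective
    change (weyl h : Smooth θ) * a * ((weyl h)⁻¹ : (Smooth θ)ˣ).val =
      ((weyl h)⁻¹⁻¹ : (Smooth θ)ˣ).val * a * ((weyl h)⁻¹ : (Smooth θ)ˣ).val
    rw [inv_inv]
  · change W ((leftMul a).completion x) = transposeCLM ((rightMul a).completion) (W x)
    induction x using UniformSpace.Completion.induction_on with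
    | hp => exact isClosed_eq (by fun_prop) (by fun_prop)
    | ih x =>
      rw [ContinuousLinearMap.completion_apply_coe, hW, hW, starSwap_leftMul]
      apply (InnerProductSpace.toDual ℂ (Forms θ τ)).symm.injective
      rw [toDual_symm_transpose, LinearIsometryEquiv.symm_apply_apply,
        LinearIsometryEquiv.symm_apply_apply, ← ContinuousLinearMap.completion_apply_coe]
      -- The transpose of R_a corresponds under the Riesz map to its adjoint R_{a*}, the operator
      -- that `starSwap_leftMul` produces from L_a.
      have h1 := map_star (rightRep θ τ) (MulOpposite.op a)
      exact congrArg (fun L : Forms θ τ →L[ℂ] Forms θ τ =>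
        L ((starSwap x : PreForms θ τ) : Forms θ τ)) h1
  · have hG := (closedGraph_DTildeCore (τ := τ) hh).1
    have hB := (closedGraph_DBarCore (τ := τ) hh).1
    have hgr := Submodule.toLinearPMap_graph_eq _ (snd_eq_zero_of_dense hB.ge
      (dense_map_fst_closedGraph (DBarCore (τ := τ) h)))
    change (x, y) ∈ (closedGraph (DBarCore (τ := τ) h)).toLinearPMap.graph ↔
      (W x, W y) ∈ (transposePMap (closedGraph (DTildeCore (τ := τ) h)).toLinearPMap).graph
    rw [hgr, mem_graph_transposePMap hG (dense_map_fst_closedGraph _)]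
    set j := (InnerProductSpace.toDual ℂ (Forms θ τ)).symm with hj
    have hjW : ∀ x : PreForms θ τ, j (W (x : Forms θ τ)) =
        ((starSwap x : PreForms θ τ) : Forms θ τ) := fun x => by
      rw [hW, hj, LinearIsometryEquiv.symm_apply_apply]
    constructor
    · intro hxy
      refine closedGraph_induction
        (P := fun p => (j (W p.1), j (W p.2)) ∈ closedGraph (DTildeCore (τ := τ) h))
        ((isClosed_closedGraph _).preimage (f := fun p : _ × _ => (j (W p.1), j (W p.2)))
          (by fun_prop)) (fun v => ?_) hxy
      dsimp only
      rw [hjW, hjW, starSwap_DBarCore hh]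
      exact coe_mem_closedGraph _ _
    · intro hxy
      have := closedGraph_induction
        (P := fun p => (W.symm (j.symm p.1), W.symm (j.symm p.2)) ∈
          closedGraph (DBarCore (τ := τ) h))
        ((isClosed_closedGraph _).preimage
          (f := fun p : _ × _ => (W.symm (j.symm p.1), W.symm (j.symm p.2)))
          (by fun_prop)) (fun u => ?_) hxy
      · simpa using this
      -- For the converse inclusion every smooth form in the core of D̃_h must come from one in the
      -- core of D̄_h; surjectivity of `starSwap` supplies it.
      · obtain ⟨v, rfl⟩ := starSwap_surjective u
        dsimp only
        rw [← starSwap_DBarCore hh, ← hjW, ← hjW, j.symm_apply_apply, j.symm_apply_apply,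
          W.symm_apply_apply, W.symm_apply_apply]
        exact coe_mem_closedGraph _ _

end Transpose

end NCTorus

end

theorem mainTheorem3 (θ : ℝ) (τ : UpperHalfPlane) (h : NCTorus.Smooth θ)
    (hh : IsSelfAdjoint h) :
    (NCTorus.tildeTriple θ τ h).IsModularSpectralTriple ∧
    (NCTorus.barTriple θ τ h).IsModularSpectralTriple ∧
    (NCTorus.barTriple θ τ h).IsIsomorphic (NCTorus.tildeTriple θ τ h).transpose
      (opOpStar (NCTorus.Smooth θ)) := by
  exact ⟨NCTorus.isModularSpectralTriple_tildeTriple τ hh,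
    NCTorus.isModularSpectralTriple_barTriple τ hh, NCTorus.isIsomorphic_transpose_tildeTriple τ hh⟩
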